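/- Let $T>0$, $D=\mathbb{R}^d/\mathbb{Z}^d$, and let $P_0$ be a continuous vector field on $D$, divergence-free (in the sense of distributions) and of zero spatial mean. For a smooth vector field $E$ on $[0,T]\times D$ put $$(LE)_{ij}=\tfrac12(\partial_jE_i+\partial_iE_j)+\partial_i\partial_j(-\Delta)^{-1}\partial^kE_k ,$$ where $(-\Delta)^{-1}$ acts on smooth functions of zero mean on $D$ and takes values of zero mean. A continuous sub-solution of the Euler equations with initial condition $P_0$ is a pair $(Z,M)$ of continuous functions on $[0,T]\times D$, valued in $\mathbb{R}^d$ and in the symmetric $d\times d$ matrices, such that $M\ge Z\otimes Z$ pointwise in the sense of symmetric matrices and $$\int_{[0,T]\times D} M^{ij}B_{ij}+(Z^i-P_0^i)E_i\,dx\,dt=0$$ for all smooth fields $(E,B)$ on $[0,T]\times D$, valued in $\mathbb{R}^d$ and in the symmetric $d\times d$ matrices, with $\partial_tB=LE$ and $B(T,\cdot)=0$. Let $\mathcal{EB}$ be the class of all pairs $(E,B)$ of bounded Borel measures on $[0,T]\times D$, valued in $\mathbb{R}^d$ and in the symmetric $d\times d$ matrices, that satisfy the weak form of these constraints, $$\int_{[0,T]\times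 D} \zeta'(t)\,\psi^{ij}(x)\,dB_{ij}-\zeta(t)\left(\partial_j\psi^{kj}+\partial^k(-\Delta)^{-1}\partial_i\partial_j\psi^{ij}\right)(x)\,dE_k=0$$ for all smooth $\zeta:[0,T]\to\mathbb{R}$ with $\zeta(0)=0$ and all smooth $\psi$ on $D$ valued in the symmetric $d\times d$ matrices. For a pair of such measures let $$K[E,B]=\sup_{M\ge Z\otimes Z}\ \frac12\int_{[0,T]\times D}2Z^i\,dE_i-\delta_{ij}M^{ij}\,dx\,dt-2M^{ij}\,dB_{ij}\ \in[0,+\infty],$$ the supremum being over all continuous $(Z,M)$ on $[0,T]\times D$, valued in $\mathbb{R}^d$ and in the symmetric matrices, with $M\ge Z\otimes Z$ pointwise; this is the meaning of $\frac12\int E\cdot(\mathbb{I}_d+2B)^{-1}\cdot E$ for measures. Finally let $$\mathcal{J}[P_0]=\sup_{(E,B)\in\mathcal{EB}}\ -K[E,B]-\int_{[0,T]\times D}P_0\cdot dE .$$ Theorem. The infimum of $\frac12\int_{[0,T]\times D}\delta_{ij}M^{ij}\,dx\,dt$ over all continuous sub-solutions $(Z,M)$ of the Euler equations with initial condition $P_0$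 is finite (in particular there are sub-solutions) and equal to $\mathcal{J}[P_0]$, and the supremum defining $\mathcal{J}[P_0]$ is attained by some $(E,B)\in\mathcal{EB}$. -/

import Mathlib

open MeasureTheory Set
open scoped ContDiff

noncomputable section

namespace EulerDuality

/-- The periodic box `D = ℝᵈ / ℤᵈ`. Its `volume` is the Lebesgue measure of total mass one. -/
abbrev Box (d : ℕ) : Type := UnitAddTorus (Fin d)

/-- The space-time domain `[0,T] × D`. -/
abbrev SpaceTime (d : ℕ) (T : ℝ) : Type := Icc (0 : ℝ) T × Box d

/-- The Lebesgue measure `dt dx` on `[0,T] × D`. -/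
def leb (d : ℕ) (T : ℝ) : Measure (SpaceTime d T) :=
  (Measure.comap (fun t : Icc (0 : ℝ) T => (t : ℝ)) volume).prod volume

/-- The covering map `ℝᵈ → D`. -/
def cover {d : ℕ} (y : Fin d → ℝ) : Box d := fun i => (y i : UnitAddCircle)

/-- Smooth real functions on `D`: those with a smooth lift to `ℝᵈ`. -/
def SmoothOnBox {d : ℕ} (f : Box d → ℝ) : Prop :=
  ContDiff ℝ ∞ (fun y : Fin d → ℝ => f (cover y))

/-- Smooth real functions on `[0,T] × D` (values at times outside `[0,T]` are irrelevant). -/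
def SmoothOnSpaceTime {d : ℕ} (T : ℝ) (f : ℝ → Box d → ℝ) : Prop :=
  ContDiffOn ℝ ∞ (fun p : ℝ × (Fin d → ℝ) => f p.1 (cover p.2)) (Icc 0 T ×ˢ univ)

/-- The partial derivative `∂ᵢ f` of a function on `D`. -/
def pderiv {d : ℕ} (i : Fin d) (f : Box d → ℝ) (x : Box d) : ℝ :=
  deriv (fun s : ℝ => f (x + cover (Pi.single i s))) 0

/-- `q = (-Δ)⁻¹ f`: the function `q` is the (unique) smooth function on `D` of zero mean such that
`-Δ q = f`. -/
def IsInvNegLaplacian {d : ℕ} (q f : Box d → ℝ) : Prop :=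
  SmoothOnBox q ∧ ∫ x, q x = 0 ∧ ∀ x, -∑ i, pderiv i (pderiv i q) x = f x

/-- A continuous vector field on `D` is divergence-free (in the sense of distributions). -/
def IsDivergenceFree {d : ℕ} (P : C(Box d, Fin d → ℝ)) : Prop :=
  ∀ φ : Box d → ℝ, SmoothOnBox φ → ∫ x, ∑ i, pderiv i φ x * P x i = 0

/-- Smooth pairs `(E, B)` on `[0,T] × D`, with `B` symmetric, such that `B(T,·) = 0` and
`∂ₜ B = L E`, where `(L E)ᵢⱼ = (∂ⱼ Eᵢ + ∂ᵢ Eⱼ) / 2 + ∂ᵢ ∂ⱼ (-Δ)⁻¹ ∂ᵏ Eₖ`. -/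
structure IsSmoothEB {d : ℕ} (T : ℝ) (E : Fin d → ℝ → Box d → ℝ)
    (B : Fin d → Fin d → ℝ → Box d → ℝ) : Prop where
  smooth_E : ∀ i, SmoothOnSpaceTime T (E i)
  smooth_B : ∀ i j, SmoothOnSpaceTime T (B i j)
  symm : ∀ i j, ∀ t ∈ Icc 0 T, ∀ x, B i j t x = B j i t x
  terminal : ∀ i j x, B i j T x = 0
  evolution : ∀ t ∈ Icc 0 T, ∃ q : Box d → ℝ,
    IsInvNegLaplacian q (fun x => ∑ k, pderiv k (E k t) x) ∧
    ∀ i j x, derivWithin (fun s => B i j s x) (Icc 0 T) t =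
      (pderiv j (E i t) x + pderiv i (E j t) x) / 2 + pderiv i (pderiv j q) x

/-- Continuous sub-solutions `(Z, M)` of the Euler equations with initial condition `P₀`:
`M ≥ Z ⊗ Z` point-wise (in particular `M` is symmetric), and
`∫ Mⁱʲ Bᵢⱼ + (Zⁱ - P₀ⁱ) Eᵢ = 0` for all smooth `(E, B)` with `∂ₜ B = L E`, `B(T,·) = 0`. -/
structure IsSubsolution {d : ℕ} (T : ℝ) (P₀ : C(Box d, Fin d → ℝ))
    (Z : C(SpaceTime d T, Fin d → ℝ)) (M : C(SpaceTime d T, Matrix (Fin d) (Fin d) ℝ)) :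
    Prop where
  ge_tensor : ∀ p, (M p - Matrix.vecMulVec (Z p) (Z p)).PosSemidef
  weak : ∀ (E : Fin d → ℝ → Box d → ℝ) (B : Fin d → Fin d → ℝ → Box d → ℝ),
    IsSmoothEB T E B →
    ∫ p : SpaceTime d T, ((∑ i, ∑ j, M p i j * B i j p.1 p.2) +
      ∑ i, (Z p i - P₀ p.2 i) * E i p.1 p.2) ∂(leb d T) = 0

/-- The energy `½ ∫ δᵢⱼ Mⁱʲ`. -/
def energy {d : ℕ} {T : ℝ} (M : C(SpaceTime d T, Matrix (Fin d) (Fin d) ℝ)) : ℝ :=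
  (1 / 2) * ∫ p : SpaceTime d T, (M p).trace ∂(leb d T)

/-- The class `ℰℬ` of pairs `(E, B)` of bounded Borel measures on `[0,T] × D`, valued in `ℝᵈ` and
in the symmetric `d × d` matrices (given by their components, which are signed measures), subject
to the weak form of `∂ₜ B = L E`, `B(T,·) = 0`: for all smooth `ζ` on `[0,T]` with `ζ(0) = 0` and
all smooth symmetric matrix fields `ψ` on `D`,
`∫ Bᵢⱼ ζ'(t) ψⁱʲ(x) - Eₖ ζ(t) (∂ⱼ ψᵏʲ + ∂ᵏ (-Δ)⁻¹ ∂ᵢ ∂ⱼ ψⁱʲ)(x) = 0`. -/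
structure IsEB {d : ℕ} (T : ℝ) (E : Fin d → SignedMeasure (SpaceTime d T))
    (B : Fin d → Fin d → SignedMeasure (SpaceTime d T)) : Prop where
  symm : ∀ i j, B i j = B j i
  weak : ∀ (ζ : ℝ → ℝ) (ψ : Fin d → Fin d → Box d → ℝ) (q : Box d → ℝ),
    ContDiffOn ℝ ∞ ζ (Icc 0 T) → ζ 0 = 0 →
    (∀ i j, SmoothOnBox (ψ i j)) → (∀ i j, ψ i j = ψ j i) →
    IsInvNegLaplacian q (fun x => ∑ i, ∑ j, pderiv i (pderiv j (ψ i j)) x) →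
    (∑ i, ∑ j, ∫ᵛ p, derivWithin ζ (Icc 0 T) (p.1 : ℝ) * ψ i j p.2 ∂•(B i j)) -
      ∑ k, ∫ᵛ p, ζ (p.1 : ℝ) * ((∑ j, pderiv j (ψ k j) p.2) + pderiv k q p.2) ∂•(E k) = 0

/-- The functional `K[E,B]`, that is `½ ∫ E · (I + 2B)⁻¹ · E`, defined for measures as
`sup ½ ∫ 2 Eᵢ Zⁱ - (δᵢⱼ + 2 Bᵢⱼ) Mⁱʲ` over all continuous `(Z, M)` with `M ≥ Z ⊗ Z`. -/
def K {d : ℕ} {T : ℝ} (E : Fin d → SignedMeasure (SpaceTime d T))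
    (B : Fin d → Fin d → SignedMeasure (SpaceTime d T)) : EReal :=
  ⨆ (Z : C(SpaceTime d T, Fin d → ℝ)) (M : C(SpaceTime d T, Matrix (Fin d) (Fin d) ℝ))
    (_ : ∀ p, (M p - Matrix.vecMulVec (Z p) (Z p)).PosSemidef),
    (((1 / 2) * (2 * (∑ i, ∫ᵛ p, Z p i ∂•(E i)) - (∫ p : SpaceTime d T, (M p).trace ∂(leb d T)) -
      2 * ∑ i, ∑ j, ∫ᵛ p, M p i j ∂•(B i j)) : ℝ) : EReal)

/-- The concave functional `-K[E,B] - ∫ P₀ · E` of the relaxed problem (never `+∞`). -/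
def relaxedObjective {d : ℕ} {T : ℝ} (P₀ : C(Box d, Fin d → ℝ))
    (E : Fin d → SignedMeasure (SpaceTime d T))
    (B : Fin d → Fin d → SignedMeasure (SpaceTime d T)) : EReal :=
  -K E B - ((∑ i, ∫ᵛ p, P₀ p.2 i ∂•(E i) : ℝ) : EReal)

/-- The optimal value `𝒥[P₀]` of the relaxed maximization problem over `ℰℬ`. -/
def relaxedValue {d : ℕ} (T : ℝ) (P₀ : C(Box d, Fin d → ℝ)) : EReal :=
  ⨆ (E : Fin d → SignedMeasure (SpaceTime d T))
    (B : Fin d → Fin d → SignedMeasure (SpaceTime d T)) (_ : IsEB T E B), relaxedObjective P₀ E B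

end EulerDuality

end

/-! The theorem is a linear-programming duality. Let `smoothAnnihilator` be the space `A` of
continuous pairs `(z, m)` orthogonal to all smooth `(E, B)`. Then `(Z, M)` is a sub-solution iff `M
≥ Z ⊗ Z` and `(Z - P₀, M) ∈ A`.

Weak duality needs every element of `A` to be orthogonal to every pair of measures in `ℰℬ`
(`IsEB.pairing_eq_zero`). This is proved on the Fourier side. At each frequency, membership in `ℰℬ`
expresses the coefficient of `B` through that of `E`, and membership in `A` expresses the
coefficient of `z` through that of `m`, with the same symbol and a primitive in time. The two
relations cancel, so all Fourier coefficients of the function obtained by translating `(z, m)` in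
space vanish, and its value at zero translation is the pairing sought. Inserting `(-Z, M)` in the
supremum defining `K` then gives `relaxedObjective_le_energy`.

For strong duality and attainment, the constraint `M ≥ Z ⊗ Z` is linearized by the cone `blockCone`
of triples `(r, Z, M)` with positive semidefinite block matrix. If `J` bounds the energies of
sub-solutions from below, the functional `energy m - J r` is nonnegative where the cone meets `{(z -
r P₀, m) ∈ A}`. M. Riesz extension makes it a functional `g` that is nonnegative on the whole cone
(`exists_extension`). Positivity on rank-one matrices turns the `M`-part of `g` into measures, and a
discriminant bound controls the `Z`-part by an `L²` norm, so it is given by measures too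
(`exists_measures`). Since `g` is the energy on `A`, and `A` contains the test fields of `ℰℬ`
(`test_mem_smoothAnnihilator`), these measures lie in `ℰℬ`. Nonnegativity of `g` at `(1, Z, M)` says
that their objective is at least `J`.

The infimum is finite because `(P₀, cI)` is a sub-solution for large `c`: the operator `L` has trace
zero, so `B` is trace-free and does not see `cI`. -/

noncomputable section
namespace EulerDuality

/-! ### Signed measures as functionals on continuous functions. -/

section SignedMeasure

variable {X : Type*} [TopologicalSpace X] [CompactSpace X] [MeasurableSpace X] [BorelSpace X]

theorem integrable_continuousMap (μ : Measure X) [IsFiniteMeasure μ] (f : C(X, ℝ)) :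
    Integrable f μ :=
  f.continuous.integrable_of_hasCompactSupport (HasCompactSupport.of_compactSpace _)

instance isFiniteMeasure_variation (s : SignedMeasure X) :
    IsFiniteMeasure (VectorMeasure.variation s) := by
  rw [← SignedMeasure.totalVariation_eq_variation]
  infer_instance

/-- Integration of continuous functions against a signed measure. -/
def pairing (s : SignedMeasure X) : C(X, ℝ) →L[ℝ] ℝ :=
  LinearMap.mkContinuous
    { toFun := fun f => ∫ᵛ p, f p ∂•s
      map_add' := fun f g => VectorMeasure.integral_fun_add
        (integrable_continuousMap _ f) (integrable_continuousMap _ g)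
      map_smul' := fun c f => VectorMeasure.integral_fun_smul s _ c f }
    ((VectorMeasure.variation s).real univ) (fun f => by
      refine (VectorMeasure.norm_integral_le_of_norm_le_const (C := ‖f‖)
        (ae_of_all _ fun x => f.norm_coe_le_norm x)).trans ?_
      have h : ‖ContinuousLinearMap.lsmul ℝ ℝ (E := ℝ)‖ ≤ 1 :=
        ContinuousLinearMap.opNorm_lsmul_le
      have h2 : 0 ≤ (VectorMeasure.variation s).real univ := measureReal_nonneg
      have h3 := norm_nonneg f
      nlinarith [mul_le_mul_of_nonneg_left h (mul_nonneg h3 h2)])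

theorem pairing_apply (s : SignedMeasure X) (f : C(X, ℝ)) : pairing s f = ∫ᵛ p, f p ∂•s := rfl

theorem lsmul_flip_real :
    (ContinuousLinearMap.lsmul ℝ ℝ (E := ℝ)).flip = ContinuousLinearMap.lsmul ℝ ℝ := by
  ext; simp

theorem pairing_toSignedMeasure (μ : Measure X) [IsFiniteMeasure μ] (f : C(X, ℝ)) :
    pairing μ.toSignedMeasure f = ∫ p, f p ∂μ := by
  rw [← VectorMeasure.integral_toSignedMeasure, lsmul_flip_real]; rfl

theorem pairing_sub (s t : SignedMeasure X) (f : C(X, ℝ)) :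
    pairing (s - t) f = pairing s f - pairing t f :=
  VectorMeasure.integral_sub_vectorMeasure (integrable_continuousMap _ f)
    (integrable_continuousMap _ f)

theorem pairing_smul (c : ℝ) (s : SignedMeasure X) (f : C(X, ℝ)) :
    pairing (c • s) f = c * pairing s f :=
  VectorMeasure.integral_smul_vectorMeasure _ c

/-- The positive and negative parts of an integrable density each give a finite measure, and the
signed measure is their difference. -/
theorem exists_signedMeasure_of_density (μ : Measure X) [IsFiniteMeasure μ] (h : X → ℝ)
    (hh : Integrable h μ) :
    ∃ s : SignedMeasure X, ∀ f : C(X, ℝ), pairing s f = ∫ x, h x * f x ∂μ := by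
  obtain ⟨h', hm, hae⟩ := hh.1
  have hh' : Integrable h' μ := hh.congr hae
  have hfin : ∀ g : X → ℝ, Integrable g μ →
      IsFiniteMeasure (μ.withDensity fun x => ((g x).toNNReal : ENNReal)) := fun g hg =>
    isFiniteMeasure_withDensity_ofReal hg.2
  have := hfin _ hh'
  have := hfin _ hh'.neg
  have meas := hm.measurable
  refine ⟨(μ.withDensity fun x => ((h' x).toNNReal : ENNReal)).toSignedMeasure -
    (μ.withDensity fun x => (((-h') x).toNNReal : ENNReal)).toSignedMeasure, fun f => ?_⟩
  have hb : ∀ g : X → ℝ, Integrable g μ → Integrable (fun x => (g x).toNNReal • f x) μ := by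
    intro g hg
    have := (hg.pos_part).mul_bdd (c := ‖f‖) f.continuous.aestronglyMeasurable
      (ae_of_all _ fun x => f.norm_coe_le_norm x)
    refine this.congr (ae_of_all _ fun x => ?_)
    simp [NNReal.smul_def, Real.coe_toNNReal']
  rw [pairing_sub, pairing_toSignedMeasure, pairing_toSignedMeasure,
    integral_withDensity_eq_integral_smul meas.real_toNNReal,
    integral_withDensity_eq_integral_smul meas.neg.real_toNNReal,
    ← integral_sub (hb _ hh') (hb _ hh'.neg)]
  refine integral_congr_ae ?_
  filter_upwards [hae] with x hx
  rw [hx]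
  simp only [NNReal.smul_def, Real.coe_toNNReal', Pi.neg_apply, smul_eq_mul, ← sub_mul]
  congr 1
  rcases le_total 0 (h' x) with h0 | h0
  · rw [max_eq_left h0, max_eq_right (by linarith)]; ring
  · rw [max_eq_right h0, max_eq_left (by linarith)]; ring

/-- A positive linear functional on `C(X, ℝ)` is represented by a finite measure. -/
theorem exists_measure_of_nonneg [T2Space X] (l : C(X, ℝ) →ₗ[ℝ] ℝ)
    (hl : ∀ f : C(X, ℝ), (∀ x, 0 ≤ f x) → 0 ≤ l f) :
    ∃ μ : Measure X, IsFiniteMeasure μ ∧ ∀ f : C(X, ℝ), ∫ x, f x ∂μ = l f := by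
  let Λ₀ : CompactlySupportedContinuousMap X ℝ →ₗ[ℝ] ℝ :=
    { toFun := fun f => l f.toContinuousMap
      map_add' := fun f g => l.map_add f.toContinuousMap g.toContinuousMap
      map_smul' := fun c f => l.map_smul c f.toContinuousMap }
  let Λ := PositiveLinearMap.mk₀ Λ₀ (fun f hf => hl _ hf)
  refine ⟨RealRMK.rieszMeasure Λ, ?_, fun f => ?_⟩
  · have : IsFiniteMeasureOnCompacts (RealRMK.rieszMeasure Λ) := by
      unfold RealRMK.rieszMeasure; infer_instance
    infer_instance
  · exact RealRMK.integral_rieszMeasure Λ (CompactlySupportedContinuousMap.continuousMapEquiv f)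

/-- A linear functional on `C(X, ℝ)` that is bounded for an `L²` seminorm is represented by a signed
measure. -/
theorem exists_signedMeasure_of_sq_le (μ : Measure X) [IsFiniteMeasure μ] (l : C(X, ℝ) →ₗ[ℝ] ℝ)
    (C : ℝ) (hl : ∀ f : C(X, ℝ), l f ^ 2 ≤ C * ∫ x, f x ^ 2 ∂μ) :
    ∃ s : SignedMeasure X, ∀ f : C(X, ℝ), pairing s f = l f := by
  let i : C(X, ℝ) →ₗ[ℝ] Lp ℝ 2 μ := (ContinuousMap.toLp (E := ℝ) 2 μ ℝ).toLinearMap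
  have hi : ∀ f, ∀ᵐ x ∂μ, i f x = f x := fun f => ContinuousMap.coeFn_toLp μ f
  have hnorm : ∀ f, ∫ x, f x ^ 2 ∂μ = ‖i f‖ ^ 2 := by
    intro f
    rw [← real_inner_self_eq_norm_sq, L2.inner_def]
    refine integral_congr_ae ?_
    filter_upwards [hi f] with x hx
    simp [hx, sq]
  -- The bound makes `l` vanish on functions that are null in `L²(μ)`, so `l` factors through the
  -- image of `C(X, ℝ)` in `L²(μ)`.
  have hker : LinearMap.ker i ≤ LinearMap.ker l := by
    intro f hf
    have := hl f
    rw [hnorm, LinearMap.mem_ker.1 hf] at this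
    simp only [norm_zero] at this
    have : l f ^ 2 ≤ 0 := by simpa using this
    exact pow_eq_zero_iff (two_ne_zero) |>.1 (le_antisymm this (sq_nonneg _))
  obtain ⟨l', hl'⟩ : ∃ l' : LinearMap.range i →ₗ[ℝ] ℝ, ∀ f, l' ⟨i f, f, rfl⟩ = l f := by
    refine ⟨((LinearMap.ker i).liftQ l hker).comp i.quotKerEquivRange.symm.toLinearMap, fun f => ?_⟩
    have : i.quotKerEquivRange.symm ⟨i f, f, rfl⟩ = Submodule.Quotient.mk f := by
      rw [LinearEquiv.symm_apply_eq]; rfl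
    simp [this]
  have hbound : ∀ v : LinearMap.range i, ‖l' v‖ ≤ Real.sqrt |C| * ‖v‖ := by
    rintro ⟨_, f, rfl⟩
    rw [hl', Real.norm_eq_abs]
    refine abs_le_of_sq_le_sq ?_ (by positivity)
    rw [mul_pow, Real.sq_sqrt (abs_nonneg _)]
    refine (hl f).trans ?_
    rw [hnorm]
    exact mul_le_mul_of_nonneg_right (le_abs_self C) (by positivity)
  -- Hahn–Banach extends the functional to all of `L²(μ)`, and the Hilbert space duality gives a
  -- density `h`, integrable because `μ` is finite.
  obtain ⟨L, hL, -⟩ := exists_extension_norm_eq _ (l'.mkContinuous _ hbound)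
  let h : Lp ℝ 2 μ := (InnerProductSpace.toDual ℝ (Lp ℝ 2 μ)).symm L
  have hint : Integrable h μ := (Lp.memLp h).integrable (by norm_num)
  obtain ⟨s, hs⟩ := exists_signedMeasure_of_density μ h hint
  refine ⟨s, fun f => ?_⟩
  have h1 : L (i f) = l f := by rw [← hl' f]; exact hL ⟨i f, f, rfl⟩
  rw [hs, ← h1, ← InnerProductSpace.toDual_symm_apply (𝕜 := ℝ) (E := Lp ℝ 2 μ), L2.inner_def]
  refine integral_congr_ae ?_
  filter_upwards [hi f] with x hx
  simp [hx, h, mul_comm]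

end SignedMeasure

/-! ### Calculus on the torus and on space-time. -/

section Torus

variable {d : ℕ} {T : ℝ}

theorem isOpenQuotientMap_cover : IsOpenQuotientMap (cover : (Fin d → ℝ) → Box d) :=
  IsOpenQuotientMap.piMap fun _ => QuotientAddGroup.isOpenQuotientMap_mk

theorem cover_add (y z : Fin d → ℝ) : cover (y + z) = cover y + cover z := by
  ext i; simp [cover]

theorem cover_zero : cover (0 : Fin d → ℝ) = 0 := by
  ext i; simp [cover]

theorem SmoothOnBox.continuous {f : Box d → ℝ} (hf : SmoothOnBox f) : Continuous f :=
  isOpenQuotientMap_cover.isQuotientMap.continuous_iff.2 (ContDiff.continuous hf)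

theorem SmoothOnBox.differentiable {f : Box d → ℝ} (hf : SmoothOnBox f) :
    Differentiable ℝ (fun y : Fin d → ℝ => f (cover y)) :=
  ContDiff.differentiable hf (by simp)

theorem SmoothOnBox.hasDerivAt {f : Box d → ℝ} (hf : SmoothOnBox f) (i : Fin d) (y : Fin d → ℝ) :
    HasDerivAt (fun s : ℝ => f (cover y + cover (Pi.single i s)))
      (fderiv ℝ (fun y : Fin d → ℝ => f (cover y)) y (Pi.single i 1)) 0 := by
  have h1 : HasDerivAt (fun s : ℝ => y + Pi.single i s) (Pi.single i (1 : ℝ)) 0 := by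
    have := (ContinuousLinearMap.single ℝ (fun _ : Fin d => ℝ) i).hasDerivAt (x := (0 : ℝ))
    exact this.const_add y
  have h2 : HasFDerivAt (fun y : Fin d → ℝ => f (cover y))
      (fderiv ℝ (fun y : Fin d → ℝ => f (cover y)) y) (y + Pi.single i (0 : ℝ)) := by
    simpa using (hf.differentiable y).hasFDerivAt
  simpa [Function.comp_def, cover_add] using h2.comp_hasDerivAt (0 : ℝ) h1

theorem SmoothOnBox.pderiv_cover {f : Box d → ℝ} (hf : SmoothOnBox f) (i : Fin d) (y : Fin d → ℝ) :
    pderiv i f (cover y) = fderiv ℝ (fun y : Fin d → ℝ => f (cover y)) y (Pi.single i 1) :=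
  (hf.hasDerivAt i y).deriv

theorem SmoothOnBox.hasDerivAt_pderiv {f : Box d → ℝ} (hf : SmoothOnBox f) (i : Fin d) (x : Box d)
    (s : ℝ) : HasDerivAt (fun s : ℝ => f (x + cover (Pi.single i s)))
      (pderiv i f (x + cover (Pi.single i s))) s := by
  obtain ⟨y, rfl⟩ := isOpenQuotientMap_cover.surjective x
  have h := hf.hasDerivAt i (y + Pi.single i s)
  rw [← hf.pderiv_cover, cover_add] at h
  have h2 := HasDerivAt.comp_sub_const (f := fun r : ℝ =>
    f (cover y + cover (Pi.single i s) + cover (Pi.single i r))) s s (by simpa using h)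
  refine h2.congr_of_eventuallyEq (Filter.Eventually.of_forall fun r => ?_)
  simp only [add_assoc]
  rw [← cover_add (Pi.single i s), ← Pi.single_add, add_sub_cancel]

theorem SmoothOnBox.pderiv {f : Box d → ℝ} (hf : SmoothOnBox f) (i : Fin d) :
    SmoothOnBox (pderiv i f) := by
  have : (fun y : Fin d → ℝ => EulerDuality.pderiv i f (cover y)) =
      fun y => fderiv ℝ (fun y : Fin d → ℝ => f (cover y)) y (Pi.single i 1) :=
    funext (hf.pderiv_cover i)
  unfold SmoothOnBox
  rw [this]
  exact (ContDiff.fderiv_right (m := ∞) hf (by simp)).clm_apply contDiff_const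

theorem SmoothOnBox.mul {f g : Box d → ℝ} (hf : SmoothOnBox f) (hg : SmoothOnBox g) :
    SmoothOnBox (fun x => f x * g x) := ContDiff.mul hf hg

theorem SmoothOnBox.const_mul {f : Box d → ℝ} (c : ℝ) (hf : SmoothOnBox f) :
    SmoothOnBox (fun x => c * f x) := ContDiff.mul contDiff_const hf

theorem SmoothOnBox.sum {ι : Type*} {s : Finset ι} {f : ι → Box d → ℝ}
    (hf : ∀ i ∈ s, SmoothOnBox (f i)) :
    SmoothOnBox (fun x => ∑ i ∈ s, f i x) := ContDiff.sum hf

theorem SmoothOnBox.hasDerivAt_zero {f : Box d → ℝ} (hf : SmoothOnBox f) (i : Fin d) (x : Box d) :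
    HasDerivAt (fun s : ℝ => f (x + cover (Pi.single i s))) (EulerDuality.pderiv i f x) 0 := by
  simpa [cover_zero] using hf.hasDerivAt_pderiv i x 0

theorem pderiv_mul {f g : Box d → ℝ} (hf : SmoothOnBox f) (hg : SmoothOnBox g) (i : Fin d)
    (x : Box d) :
    pderiv i (fun x => f x * g x) x = pderiv i f x * g x + f x * pderiv i g x := by
  have := ((hf.hasDerivAt_zero i x).mul (hg.hasDerivAt_zero i x)).deriv
  simp only [Pi.single_zero, cover_zero, add_zero] at this
  exact this

theorem pderiv_const_mul {f : Box d → ℝ} (hf : SmoothOnBox f) (c : ℝ) (i : Fin d) :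
    pderiv i (fun x => c * f x) = fun x => c * pderiv i f x :=
  funext fun x => ((hf.hasDerivAt_zero i x).const_mul c).deriv

theorem integrable_box {f : Box d → ℝ} (hf : Continuous f) : Integrable f :=
  hf.integrable_of_hasCompactSupport (HasCompactSupport.of_compactSpace _)

/-- By translation invariance, `s ↦ ∫ f(x + s eᵢ)` is constant; its derivative at `0`, taken under
the integral, is `∫ ∂ᵢ f`. -/
theorem integral_pderiv {f : Box d → ℝ} (hf : SmoothOnBox f) (i : Fin d) :
    ∫ x, pderiv i f x = 0 := by
  have hc := (hf.pderiv i).continuous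
  obtain ⟨C, hC⟩ := IsCompact.exists_bound_of_continuousOn isCompact_univ hc.continuousOn
  have h := hasDerivAt_integral_of_dominated_loc_of_deriv_le (μ := (volume : Measure (Box d)))
    (F := fun (s : ℝ) x => f (x + cover (Pi.single i s)))
    (F' := fun (s : ℝ) x => pderiv i f (x + cover (Pi.single i s))) (x₀ := 0)
    (bound := fun _ => C) (s := univ) Filter.univ_mem
    (Filter.Eventually.of_forall fun s => (hf.continuous.comp (by fun_prop)).aestronglyMeasurable)
    (integrable_box (hf.continuous.comp (by fun_prop)))
    (hc.comp (by fun_prop)).aestronglyMeasurable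
    (ae_of_all _ fun x s _ => hC _ (mem_univ _)) (integrable_const C)
    (ae_of_all _ fun x s _ => hf.hasDerivAt_pderiv i x s)
  have h2 := h.2
  simp only [integral_add_right_eq_self (μ := (volume : Measure (Box d)))] at h2
  exact h2.unique (hasDerivAt_const _ _)

theorem integral_pderiv_mul {f g : Box d → ℝ} (hf : SmoothOnBox f) (hg : SmoothOnBox g)
    (i : Fin d) : ∫ x, pderiv i f x * g x = - ∫ x, f x * pderiv i g x := by
  have h := integral_pderiv (hf.mul hg) i
  simp only [pderiv_mul hf hg] at h
  rw [integral_add (integrable_box ((hf.pderiv i).mul hg).continuous)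
    (integrable_box (hf.mul (hg.pderiv i)).continuous)] at h
  linarith

theorem SmoothOnSpaceTime.smoothOnBox {f : ℝ → Box d → ℝ} (hf : SmoothOnSpaceTime T f) {t : ℝ}
    (ht : t ∈ Icc 0 T) : SmoothOnBox (f t) := by
  have : ContDiffOn ℝ ∞ (fun y : Fin d → ℝ => f t (cover y)) univ :=
    ContDiffOn.comp (f := fun y : Fin d → ℝ => (t, y)) hf
      (contDiff_const.prodMk contDiff_id).contDiffOn (fun y _ => ⟨ht, mem_univ _⟩)
  exact contDiffOn_univ.1 this

/-- The map `[0,T] × ℝᵈ → [0,T] × D` is an open quotient map, so continuity may be tested on lifts.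
The value `0` outside `[0,T]` is a placeholder. -/
theorem continuous_spaceTime_of_lift {g : SpaceTime d T → ℝ}
    (hg : ContinuousOn (fun p : ℝ × (Fin d → ℝ) =>
      if h : p.1 ∈ Icc 0 T then g (⟨p.1, h⟩, cover p.2) else 0) (Icc 0 T ×ˢ univ)) :
    Continuous g := by
  have hq : IsOpenQuotientMap (Prod.map id cover : Icc (0 : ℝ) T × (Fin d → ℝ) → SpaceTime d T) :=
    IsOpenQuotientMap.id.prodMap isOpenQuotientMap_cover
  rw [hq.isQuotientMap.continuous_iff]
  have : Continuous (fun p : Icc (0 : ℝ) T × (Fin d → ℝ) => ((p.1 : ℝ), p.2)) := by fun_prop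
  have := hg.comp_continuous this (fun p => ⟨p.1.2, mem_univ _⟩)
  refine this.congr fun p => ?_
  simp [p.1.2.1, p.1.2.2, Prod.map]

theorem SmoothOnSpaceTime.continuous {f : ℝ → Box d → ℝ} (hf : SmoothOnSpaceTime T f) :
    Continuous (fun p : SpaceTime d T => f p.1 p.2) :=
  continuous_spaceTime_of_lift <| hf.continuousOn.congr fun p hp => by
    simp only [mem_prod, mem_univ, and_true] at hp
    simp [hp]

theorem SmoothOnSpaceTime.contDiffOn_time {f : ℝ → Box d → ℝ} (hf : SmoothOnSpaceTime T f)
    (x : Box d) : ContDiffOn ℝ ∞ (fun s => f s x) (Icc 0 T) := by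
  obtain ⟨y, rfl⟩ := isOpenQuotientMap_cover.surjective x
  exact ContDiffOn.comp (f := fun s : ℝ => (s, y)) hf
      (contDiff_id.prodMk contDiff_const).contDiffOn (fun s hs => ⟨hs, mem_univ _⟩)

theorem SmoothOnSpaceTime.continuous_derivWithin (hT : 0 < T) {f : ℝ → Box d → ℝ}
    (hf : SmoothOnSpaceTime T f) :
    Continuous (fun p : SpaceTime d T => derivWithin (fun s => f s p.2) (Icc 0 T) p.1) := by
  have hu : UniqueDiffOn ℝ (Icc (0 : ℝ) T) := uniqueDiffOn_Icc hT
  have hu2 : UniqueDiffOn ℝ (Icc (0 : ℝ) T ×ˢ (univ : Set (Fin d → ℝ))) := hu.prod uniqueDiffOn_univ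
  have h1 := ContDiffOn.continuousOn_fderivWithin hf hu2 (by simp)
  refine continuous_spaceTime_of_lift ?_
  have h2 : ContinuousOn (fun p : ℝ × (Fin d → ℝ) => fderivWithin ℝ
    (fun p : ℝ × (Fin d → ℝ) => f p.1 (cover p.2)) (Icc 0 T ×ˢ univ) p (1, 0)) (Icc 0 T ×ˢ univ) :=
    h1.clm_apply continuousOn_const
  refine h2.congr fun p hp => ?_
  have hp' := hp
  simp only [mem_prod, mem_univ, and_true] at hp
  rw [dif_pos hp]
  have hd : HasFDerivWithinAt (fun p : ℝ × (Fin d → ℝ) => f p.1 (cover p.2)) _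
      (Icc 0 T ×ˢ univ) (p.1, p.2) :=
    ((ContDiffOn.differentiableOn hf (by simp)) p hp').hasFDerivWithinAt
  have hl : HasDerivWithinAt (fun s : ℝ => (s, p.2)) ((1 : ℝ), (0 : Fin d → ℝ)) (Icc 0 T) p.1 :=
    (hasDerivWithinAt_id _ _).prodMk (hasDerivWithinAt_const _ _ _)
  exact (hd.comp_hasDerivWithinAt p.1 hl (fun s hs => mk_mem_prod hs (mem_univ _))).derivWithin (hu _ hp)

instance isFiniteMeasure_time :
    IsFiniteMeasure (Measure.comap (fun t : Icc (0 : ℝ) T => (t : ℝ)) volume) := by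
  refine ⟨?_⟩
  rw [comap_subtype_coe_apply measurableSet_Icc]
  simpa using! measure_Icc_lt_top

instance isFiniteMeasure_leb : IsFiniteMeasure (leb d T) := by
  unfold leb; infer_instance

theorem integrable_leb {f : SpaceTime d T → ℝ} (hf : Continuous f) : Integrable f (leb d T) :=
  integrable_continuousMap _ ⟨f, hf⟩

theorem integral_leb {f : SpaceTime d T → ℝ} (hf : Continuous f) :
    ∫ p, f p ∂(leb d T) =
      ∫ t, (∫ x, f (t, x)) ∂(Measure.comap (fun t : Icc (0 : ℝ) T => (t : ℝ)) volume) :=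
  integral_prod _ (integrable_leb hf)

theorem integral_leb_symm {f : SpaceTime d T → ℝ} (hf : Continuous f) :
    ∫ p, f p ∂(leb d T) =
      ∫ x, (∫ t, f (t, x) ∂(Measure.comap (fun t : Icc (0 : ℝ) T => (t : ℝ)) volume)) :=
  integral_prod_symm _ (integrable_leb hf)

theorem integral_time (hT : 0 ≤ T) (f : ℝ → ℝ) :
    ∫ t : Icc (0 : ℝ) T, f t ∂(Measure.comap (fun t : Icc (0 : ℝ) T => (t : ℝ)) volume) =
      ∫ t in (0 : ℝ)..T, f t := by
  rw [intervalIntegral.integral_of_le hT, ← integral_Icc_eq_integral_Ioc]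
  exact integral_subtype_comap measurableSet_Icc f

end Torus

/-! ### The annihilator of the smooth pairs `(E, B)`. -/

section Annihilator

variable {d : ℕ} {T : ℝ}

theorem SmoothOnBox.integrable {f : Box d → ℝ} (hf : SmoothOnBox f) : Integrable f :=
  integrable_box hf.continuous

/-- Self-adjointness of `(-Δ)⁻¹`, from two integrations by parts in each direction. -/
theorem IsInvNegLaplacian.integral_mul_comm {q r f g : Box d → ℝ} (hq : IsInvNegLaplacian q f)
    (hr : IsInvNegLaplacian r g) : ∫ x, f x * r x = ∫ x, q x * g x := by
  have h : ∀ i, ∫ x, pderiv i (pderiv i q) x * r x = ∫ x, q x * pderiv i (pderiv i r) x := by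
    intro i
    rw [integral_pderiv_mul (hq.1.pderiv i) hr.1, integral_pderiv_mul hq.1 (hr.1.pderiv i), neg_neg]
  simp only [← hq.2.2, ← hr.2.2, neg_mul, mul_neg, Finset.sum_mul, Finset.mul_sum, integral_neg]
  rw [integral_finsetSum _ fun i _ => (((hq.1.pderiv i).pderiv i).mul hr.1).integrable,
    integral_finsetSum _ fun i _ => (hq.1.mul ((hr.1.pderiv i).pderiv i)).integrable]
  simp only [h]

/-- Duality between the operator `L` and its formal adjoint, for smooth fields on the torus. -/
theorem integral_duality {ψ : Fin d → Fin d → Box d → ℝ} {q r : Box d → ℝ} {E : Fin d → Box d → ℝ}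
    (hψ : ∀ i j, SmoothOnBox (ψ i j)) (hsymm : ∀ i j, ψ i j = ψ j i)
    (hq : IsInvNegLaplacian q (fun x => ∑ i, ∑ j, pderiv i (pderiv j (ψ i j)) x))
    (hE : ∀ i, SmoothOnBox (E i))
    (hr : IsInvNegLaplacian r (fun x => ∑ k, pderiv k (E k) x)) :
    ∫ x, ((∑ i, ∑ j, ψ i j x *
      ((pderiv j (E i) x + pderiv i (E j) x) / 2 + pderiv i (pderiv j r) x)) +
      ∑ k, ((∑ j, pderiv j (ψ k j) x) + pderiv k q x) * E k x) = 0 := by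
  have hA : ∀ i j l m, ∫ x, ψ i j x * pderiv l (E m) x = - ∫ x, pderiv l (ψ i j) x * E m x := by
    intro i j l m
    rw [integral_pderiv_mul (hψ i j) (hE m), neg_neg]
  have hD : ∀ i j, ∫ x, ψ i j x * pderiv i (pderiv j r) x =
      ∫ x, pderiv j (pderiv i (ψ i j)) x * r x := by
    intro i j
    rw [integral_pderiv_mul ((hψ i j).pderiv i) hr.1, integral_pderiv_mul (hψ i j) (hr.1.pderiv j),
      neg_neg]
  have hI := hr.1
  have hQ := hq.1
  have e1 : ∀ x, ((∑ i, ∑ j, ψ i j x *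
      ((pderiv j (E i) x + pderiv i (E j) x) / 2 + pderiv i (pderiv j r) x)) +
      ∑ k, ((∑ j, pderiv j (ψ k j) x) + pderiv k q x) * E k x) =
      (∑ i, ∑ j, (1 / 2 * (ψ i j x * pderiv j (E i) x) + 1 / 2 * (ψ i j x * pderiv i (E j) x) +
        ψ i j x * pderiv i (pderiv j r) x)) + ∑ k, ((∑ j, pderiv j (ψ k j) x * E k x) +
          pderiv k q x * E k x) := by
    intro x
    congr 1
    · refine Finset.sum_congr rfl fun i _ => Finset.sum_congr rfl fun j _ => ?_
      ring
    · refine Finset.sum_congr rfl fun i _ => ?_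
      rw [add_mul, Finset.sum_mul]
  have i1 : ∀ i j, SmoothOnBox (fun x => 1 / 2 * (ψ i j x * pderiv j (E i) x)) := fun i j =>
    ((hψ i j).mul ((hE i).pderiv j)).const_mul _
  have i2 : ∀ i j, SmoothOnBox (fun x => 1 / 2 * (ψ i j x * pderiv i (E j) x)) := fun i j =>
    ((hψ i j).mul ((hE j).pderiv i)).const_mul _
  have i3 : ∀ i j, SmoothOnBox (fun x => ψ i j x * pderiv i (pderiv j r) x) := fun i j =>
    (hψ i j).mul ((hI.pderiv j).pderiv i)
  have i4 : ∀ i j, SmoothOnBox (fun x => 1 / 2 * (ψ i j x * pderiv j (E i) x) +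
      1 / 2 * (ψ i j x * pderiv i (E j) x)) := fun i j => ContDiff.add (i1 i j) (i2 i j)
  have i5 : ∀ i j, SmoothOnBox (fun x => 1 / 2 * (ψ i j x * pderiv j (E i) x) +
      1 / 2 * (ψ i j x * pderiv i (E j) x) + ψ i j x * pderiv i (pderiv j r) x) :=
    fun i j => ContDiff.add (i4 i j) (i3 i j)
  have i6 : ∀ i j k, SmoothOnBox (fun x => pderiv k (ψ i j) x * E i x) := fun i j k =>
    ((hψ i j).pderiv k).mul (hE i)
  have i7 : ∀ k, SmoothOnBox (fun x => pderiv k q x * E k x) := fun k => (hQ.pderiv k).mul (hE k)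
  have i8 : ∀ k, SmoothOnBox (fun x => ∑ j, pderiv j (ψ k j) x * E k x) := fun k =>
    SmoothOnBox.sum fun j _ => i6 k j j
  have i9 : ∀ k, SmoothOnBox (fun x => (∑ j, pderiv j (ψ k j) x * E k x) + pderiv k q x * E k x) :=
    fun k => ContDiff.add (i8 k) (i7 k)
  simp only [e1]
  rw [integral_add (SmoothOnBox.sum fun i _ => SmoothOnBox.sum fun j _ => i5 i j).integrable
    (SmoothOnBox.sum fun k _ => i9 k).integrable,
    integral_finsetSum _ fun i _ => (SmoothOnBox.sum fun j _ => i5 i j).integrable,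
    integral_finsetSum _ fun k _ => (i9 k).integrable]
  have e2 : ∀ i, ∫ x, ∑ j, (1 / 2 * (ψ i j x * pderiv j (E i) x) +
      1 / 2 * (ψ i j x * pderiv i (E j) x) + ψ i j x * pderiv i (pderiv j r) x) =
      ∑ j, (-(1 / 2) * (∫ x, pderiv j (ψ i j) x * E i x) +
        -(1 / 2) * (∫ x, pderiv i (ψ j i) x * E j x) + ∫ x, pderiv j (pderiv i (ψ j i)) x * r x) := by
    intro i
    rw [integral_finsetSum _ fun j _ => (i5 i j).integrable]
    refine Finset.sum_congr rfl fun j _ => ?_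
    rw [integral_add (i4 i j).integrable (i3 i j).integrable,
      integral_add (i1 i j).integrable (i2 i j).integrable, integral_const_mul, integral_const_mul,
      hA, hA, hD, hsymm j i]
    ring
  have e3 : ∀ k, ∫ x, ((∑ j, pderiv j (ψ k j) x * E k x) + pderiv k q x * E k x) =
      (∑ j, ∫ x, pderiv j (ψ k j) x * E k x) + ∫ x, pderiv k q x * E k x := by
    intro k
    rw [integral_add (i8 k).integrable (i7 k).integrable,
      integral_finsetSum _ fun j _ => (i6 k j j).integrable]
  simp only [e2, e3]
  simp only [Finset.sum_add_distrib]
  have e4 : ∑ i, ∑ j, -(1 / 2) * (∫ x, pderiv i (ψ j i) x * E j x) =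
      ∑ i, ∑ j, -(1 / 2) * (∫ x, pderiv j (ψ i j) x * E i x) := Finset.sum_comm
  -- The nonlocal terms cancel: self-adjointness moves `(-Δ)⁻¹` from `∂ᵏ Eₖ` to `∂ᵢ ∂ⱼ ψⁱʲ`, and one
  -- more integration by parts leaves `-∇q · E`.
  have e5 : ∑ i, ∑ j, ∫ x, pderiv j (pderiv i (ψ j i)) x * r x = - ∑ k, ∫ x, pderiv k q x * E k x := by
    have h := hq.integral_mul_comm hr
    simp only [Finset.sum_mul, Finset.mul_sum] at h
    rw [integral_finsetSum _ fun i _ => (SmoothOnBox.sum fun j _ =>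
      (((hψ i j).pderiv j).pderiv i).mul hI).integrable,
      integral_finsetSum _ fun k _ => (hQ.mul ((hE k).pderiv k)).integrable] at h
    have h2 : ∀ i, ∫ x, ∑ j, pderiv i (pderiv j (ψ i j)) x * r x =
        ∑ j, ∫ x, pderiv i (pderiv j (ψ i j)) x * r x := fun i =>
      integral_finsetSum _ fun j _ => ((((hψ i j).pderiv j).pderiv i).mul hI).integrable
    simp only [h2] at h
    rw [Finset.sum_comm, h, ← Finset.sum_neg_distrib]
    refine Finset.sum_congr rfl fun k _ => ?_
    rw [integral_pderiv_mul hQ (hE k), neg_neg]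
  rw [e4, e5]
  simp only [← Finset.mul_sum]
  ring

theorem integral_time_parts (hT : 0 < T) {u v : ℝ → ℝ} (hu : ContDiffOn ℝ ∞ u (Icc 0 T))
    (hv : ContDiffOn ℝ ∞ v (Icc 0 T)) :
    ∫ t : Icc (0 : ℝ) T, (derivWithin u (Icc 0 T) t * v t + u t * derivWithin v (Icc 0 T) t)
      ∂(Measure.comap (fun t : Icc (0 : ℝ) T => (t : ℝ)) volume) = u T * v T - u 0 * v 0 := by
  have hU : UniqueDiffOn ℝ (Icc (0 : ℝ) T) := uniqueDiffOn_Icc hT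
  rw [integral_time hT.le (fun t => derivWithin u (Icc 0 T) t * v t + u t * derivWithin v (Icc 0 T) t)]
  have hd : ∀ {w : ℝ → ℝ}, ContDiffOn ℝ ∞ w (Icc 0 T) → ∀ x ∈ Ioo 0 T,
      HasDerivAt w (derivWithin w (Icc 0 T) x) x := fun hw x hx =>
    ((hw.differentiableOn (by simp)) x (Ioo_subset_Icc_self hx)).hasDerivWithinAt.hasDerivAt
      (Icc_mem_nhds hx.1 hx.2)
  have hc : ∀ {w : ℝ → ℝ}, ContDiffOn ℝ ∞ w (Icc 0 T) →
      ContinuousOn (derivWithin w (Icc 0 T)) (Icc 0 T) := fun hw =>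
    hw.continuousOn_derivWithin hU (by simp)
  refine intervalIntegral.integral_eq_sub_of_hasDerivAt_of_le hT.le
    (f := fun t => u t * v t) (hu.continuousOn.mul hv.continuousOn)
    (fun x hx => (hd hu x hx).mul (hd hv x hx)) ?_
  refine ContinuousOn.intervalIntegrable ?_
  rw [uIcc_of_le hT.le]
  exact ((hc hu).mul hv.continuousOn).add (hu.continuousOn.mul (hc hv))

/-- The smooth fields `(E, B)` satisfy the weak form of the constraint. -/
theorem IsSmoothEB.integral_eq_zero (hT : 0 < T) {E : Fin d → ℝ → Box d → ℝ}
    {B : Fin d → Fin d → ℝ → Box d → ℝ} (h : IsSmoothEB T E B) {ζ : ℝ → ℝ}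
    {ψ : Fin d → Fin d → Box d → ℝ} {q : Box d → ℝ} (hζ : ContDiffOn ℝ ∞ ζ (Icc 0 T))
    (hζ0 : ζ 0 = 0) (hψ : ∀ i j, SmoothOnBox (ψ i j)) (hsymm : ∀ i j, ψ i j = ψ j i)
    (hq : IsInvNegLaplacian q (fun x => ∑ i, ∑ j, pderiv i (pderiv j (ψ i j)) x)) :
    ∫ p : SpaceTime d T, ((∑ i, ∑ j, derivWithin ζ (Icc 0 T) p.1 * ψ i j p.2 * B i j p.1 p.2) +
      ∑ k, -(ζ p.1 * ((∑ j, pderiv j (ψ k j) p.2) + pderiv k q p.2)) * E k p.1 p.2) ∂(leb d T) = 0 := by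
  have hU : UniqueDiffOn ℝ (Icc (0 : ℝ) T) := uniqueDiffOn_Icc hT
  have cζ : Continuous (fun p : SpaceTime d T => ζ p.1) :=
    hζ.continuousOn.comp_continuous (by fun_prop) fun p => p.1.2
  have cζ' : Continuous (fun p : SpaceTime d T => derivWithin ζ (Icc 0 T) p.1) :=
    (hζ.continuousOn_derivWithin hU (by simp)).comp_continuous (by fun_prop) fun p => p.1.2
  have cψ : ∀ i j, Continuous (fun p : SpaceTime d T => ψ i j p.2) := fun i j =>
    (hψ i j).continuous.comp continuous_snd
  have cdψ : ∀ i j k, Continuous (fun p : SpaceTime d T => pderiv k (ψ i j) p.2) := fun i j k =>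
    ((hψ i j).pderiv k).continuous.comp continuous_snd
  have cq : ∀ k, Continuous (fun p : SpaceTime d T => pderiv k q p.2) := fun k =>
    (hq.1.pderiv k).continuous.comp continuous_snd
  have cE := fun i => (h.smooth_E i).continuous
  have cB := fun i j => (h.smooth_B i j).continuous
  have cb := fun i j => (h.smooth_B i j).continuous_derivWithin hT
  let b := fun i j (p : SpaceTime d T) => derivWithin (fun s => B i j s p.2) (Icc 0 T) p.1
  change ∀ i j, Continuous (b i j) at cb
  -- `F` is `ψ : ∂ₜ(ζ B)`, which integrates to zero in time because `ζ(0) = 0` and `B(T) = 0`. `G`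
  -- is `ζ` times the integrand of `integral_duality`, which integrates to zero in space.
  let F := fun p : SpaceTime d T => ∑ i, ∑ j, ψ i j p.2 *
    (derivWithin ζ (Icc 0 T) p.1 * B i j p.1 p.2 + ζ p.1 * b i j p)
  let G := fun p : SpaceTime d T => ζ p.1 * ((∑ i, ∑ j, ψ i j p.2 * b i j p) +
      ∑ k, ((∑ j, pderiv j (ψ k j) p.2) + pderiv k q p.2) * E k p.1 p.2)
  have cF : Continuous F := continuous_finsetSum _ fun i _ => continuous_finsetSum _ fun j _ =>
    (cψ i j).mul ((cζ'.mul (cB i j)).add (cζ.mul (cb i j)))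
  have cG : Continuous G := cζ.mul <| (continuous_finsetSum _ fun i _ => continuous_finsetSum _
    fun j _ => (cψ i j).mul (cb i j)).add <| continuous_finsetSum _ fun k _ =>
      ((continuous_finsetSum _ fun j _ => cdψ k j j).add (cq k)).mul (cE k)
  have e : ∀ p : SpaceTime d T,
      ((∑ i, ∑ j, derivWithin ζ (Icc 0 T) p.1 * ψ i j p.2 * B i j p.1 p.2) +
      ∑ k, -(ζ p.1 * ((∑ j, pderiv j (ψ k j) p.2) + pderiv k q p.2)) * E k p.1 p.2) = F p - G p := by
    intro p
    have f1 : F p = (∑ i, ∑ j, derivWithin ζ (Icc 0 T) p.1 * ψ i j p.2 * B i j p.1 p.2) +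
        ζ p.1 * ∑ i, ∑ j, ψ i j p.2 * b i j p := by
      simp only [F, Finset.mul_sum, ← Finset.sum_add_distrib]
      refine Finset.sum_congr rfl fun i _ => Finset.sum_congr rfl fun j _ => ?_
      ring
    have f2 : ∑ k, -(ζ p.1 * ((∑ j, pderiv j (ψ k j) p.2) + pderiv k q p.2)) * E k p.1 p.2 =
        -(ζ p.1 * ∑ k, ((∑ j, pderiv j (ψ k j) p.2) + pderiv k q p.2) * E k p.1 p.2) := by
      rw [Finset.mul_sum, ← Finset.sum_neg_distrib]
      refine Finset.sum_congr rfl fun i _ => ?_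
      ring
    rw [f1, f2]
    simp only [G]
    ring
  simp only [e]
  rw [integral_sub (integrable_leb cF) (integrable_leb cG), integral_leb_symm cF, integral_leb cG]
  have hF : ∀ x, ∫ t, F (t, x) ∂(Measure.comap (fun t : Icc (0 : ℝ) T => (t : ℝ)) volume) = 0 := by
    intro x
    have ci : ∀ i j, Continuous (fun t : Icc (0 : ℝ) T => ψ i j x *
        (derivWithin ζ (Icc 0 T) t * B i j t x + ζ t * b i j (t, x))) := fun i j => by
      have : Continuous (fun t : Icc (0 : ℝ) T => ((t, x) : SpaceTime d T)) := by fun_prop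
      have h1 := (cζ'.mul (cB i j)).add (cζ.mul (cb i j))
      exact continuous_const.mul (h1.comp this)
    have ii : ∀ i j, Integrable (fun t : Icc (0 : ℝ) T => ψ i j x *
        (derivWithin ζ (Icc 0 T) t * B i j t x + ζ t * b i j (t, x)))
        (Measure.comap (fun t : Icc (0 : ℝ) T => (t : ℝ)) volume) := fun i j =>
      integrable_continuousMap _ ⟨_, ci i j⟩
    simp only [F]
    rw [integral_finsetSum _ fun i _ => integrable_finsetSum _ fun j _ => ii i j]
    refine Finset.sum_eq_zero fun i _ => ?_
    rw [integral_finsetSum _ fun j _ => ii i j]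
    refine Finset.sum_eq_zero fun j _ => ?_
    rw [integral_const_mul]
    have := integral_time_parts hT hζ ((h.smooth_B i j).contDiffOn_time x)
    simp only [hζ0, h.terminal, mul_zero, zero_mul, sub_zero] at this
    simp only [b, this, mul_zero]
  have hG : ∀ t, ∫ x, G (t, x) = 0 := by
    intro t
    obtain ⟨r, hr, hb⟩ := h.evolution t t.2
    simp only [G, b, hb]
    rw [integral_const_mul, integral_duality hψ hsymm hq
      (fun i => (h.smooth_E i).smoothOnBox t.2) hr, mul_zero]
  simp only [hF, hG, integral_zero, sub_zero]

/-- The trace of `L E` is `∂ᵏ Eₖ + Δ (-Δ)⁻¹ ∂ᵏ Eₖ = 0`, so the trace of `B` is constant in time and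
equals its terminal value `0`. -/
theorem IsSmoothEB.trace_eq_zero (hT : 0 < T) {E : Fin d → ℝ → Box d → ℝ}
    {B : Fin d → Fin d → ℝ → Box d → ℝ} (h : IsSmoothEB T E B) {t : ℝ} (ht : t ∈ Icc 0 T)
    (x : Box d) : ∑ i, B i i t x = 0 := by
  have hU : UniqueDiffOn ℝ (Icc (0 : ℝ) T) := uniqueDiffOn_Icc hT
  have hdiff : ∀ i j, DifferentiableOn ℝ (fun s => B i j s x) (Icc 0 T) := fun i j =>
    ((h.smooth_B i j).contDiffOn_time x).differentiableOn (by simp)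
  have hd : ∀ s ∈ Ico 0 T, derivWithin (fun s => ∑ i, B i i s x) (Icc 0 T) s = 0 := by
    intro s hs
    have hs' := Ico_subset_Icc_self hs
    obtain ⟨r, hr, hb⟩ := h.evolution s hs'
    have h1 : HasDerivWithinAt (fun s => ∑ i, B i i s x)
        (∑ i, derivWithin (fun s => B i i s x) (Icc 0 T) s) (Icc 0 T) s :=
      HasDerivWithinAt.fun_sum fun i _ => (hdiff i i s hs').hasDerivWithinAt
    rw [h1.derivWithin (hU s hs')]
    simp only [hb, Finset.sum_add_distrib, add_self_div_two]
    have := hr.2.2 x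
    simp only at this
    linarith
  have hc := constant_of_derivWithin_zero (DifferentiableOn.fun_sum fun i _ => hdiff i i) hd
  rw [hc t ht, ← hc T (right_mem_Icc.2 hT.le)]
  simp [h.terminal]

theorem continuous_entry (m : C(SpaceTime d T, Matrix (Fin d) (Fin d) ℝ)) (i j : Fin d) :
    Continuous (fun p => m p i j) := m.continuous.matrix_elem i j

theorem continuous_component (z : C(SpaceTime d T, Fin d → ℝ)) (i : Fin d) :
    Continuous (fun p => z p i) := (continuous_apply i).comp z.continuous

theorem IsSmoothEB.continuous_integrand {E : Fin d → ℝ → Box d → ℝ}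
    {B : Fin d → Fin d → ℝ → Box d → ℝ} (h : IsSmoothEB T E B) (z : C(SpaceTime d T, Fin d → ℝ))
    (m : C(SpaceTime d T, Matrix (Fin d) (Fin d) ℝ)) :
    Continuous (fun p : SpaceTime d T => (∑ i, ∑ j, m p i j * B i j p.1 p.2) +
      ∑ i, z p i * E i p.1 p.2) := by
  have cE := fun i => (h.smooth_E i).continuous
  have cB := fun i j => (h.smooth_B i j).continuous
  have cm := continuous_entry m
  have cz := continuous_component z
  exact (continuous_finsetSum _ fun i _ => continuous_finsetSum _ fun j _ =>
    (cm i j).mul (cB i j)).add (continuous_finsetSum _ fun i _ => (cz i).mul (cE i))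

variable (d T) in
/-- The continuous pairs `(z, m)` that annihilate all smooth `(E, B)` with `∂ₜ B = L E` and
`B(T,·) = 0`. -/
def smoothAnnihilator :
    Submodule ℝ (C(SpaceTime d T, Fin d → ℝ) × C(SpaceTime d T, Matrix (Fin d) (Fin d) ℝ)) where
  carrier := {w | ∀ (E : Fin d → ℝ → Box d → ℝ) (B : Fin d → Fin d → ℝ → Box d → ℝ),
    IsSmoothEB T E B → ∫ p : SpaceTime d T, ((∑ i, ∑ j, w.2 p i j * B i j p.1 p.2) +
      ∑ i, w.1 p i * E i p.1 p.2) ∂(leb d T) = 0}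
  zero_mem' := by intro E B _; simp
  add_mem' := by
    intro a b ha hb E B h
    have e := integral_add (integrable_leb (h.continuous_integrand a.1 a.2))
      (integrable_leb (h.continuous_integrand b.1 b.2))
    rw [ha E B h, hb E B h, add_zero] at e
    refine Eq.trans (integral_congr_ae (ae_of_all _ fun p => ?_)) e
    simp only [Prod.snd_add, Prod.fst_add, ContinuousMap.add_apply, Matrix.add_apply, Pi.add_apply,
      add_mul, Finset.sum_add_distrib]
    ring
  smul_mem' := by
    intro c a ha E B h
    have e := integral_const_mul (μ := leb d T) c (fun p : SpaceTime d T =>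
      (∑ i, ∑ j, a.2 p i j * B i j p.1 p.2) + ∑ i, a.1 p i * E i p.1 p.2)
    rw [ha E B h, mul_zero] at e
    refine Eq.trans (integral_congr_ae (ae_of_all _ fun p => ?_)) e
    simp only [Prod.smul_snd, Prod.smul_fst, ContinuousMap.smul_apply, Matrix.smul_apply,
      Pi.smul_apply, smul_eq_mul, mul_add, Finset.mul_sum, mul_assoc]

/-- These `(z, m)` are the test fields in the weak form defining `ℰℬ`. A functional that vanishes on
the annihilator therefore satisfies that weak form. -/
theorem test_mem_smoothAnnihilator (hT : 0 < T) {ζ : ℝ → ℝ}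
    {ψ : Fin d → Fin d → Box d → ℝ} {q : Box d → ℝ} (hζ : ContDiffOn ℝ ∞ ζ (Icc 0 T))
    (hζ0 : ζ 0 = 0) (hψ : ∀ i j, SmoothOnBox (ψ i j)) (hsymm : ∀ i j, ψ i j = ψ j i)
    (hq : IsInvNegLaplacian q (fun x => ∑ i, ∑ j, pderiv i (pderiv j (ψ i j)) x))
    {z : C(SpaceTime d T, Fin d → ℝ)} {m : C(SpaceTime d T, Matrix (Fin d) (Fin d) ℝ)}
    (hz : ∀ p k, z p k = -(ζ p.1 * ((∑ j, pderiv j (ψ k j) p.2) + pderiv k q p.2)))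
    (hm : ∀ p i j, m p i j = derivWithin ζ (Icc 0 T) p.1 * ψ i j p.2) :
    (z, m) ∈ smoothAnnihilator d T := by
  intro E B h
  simp only [hz, hm]
  exact h.integral_eq_zero hT hζ hζ0 hψ hsymm hq

/-- Since `B` is trace-free, multiples of the identity cost nothing in the constraint; they supply
sub-solutions and the room needed for the extension theorem. -/
theorem scalar_mem_smoothAnnihilator (hT : 0 < T) (c : ℝ) :
    ((0, ContinuousMap.const _ (c • (1 : Matrix (Fin d) (Fin d) ℝ))) :
      C(SpaceTime d T, Fin d → ℝ) × C(SpaceTime d T, Matrix (Fin d) (Fin d) ℝ)) ∈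
      smoothAnnihilator d T := by
  intro E B h
  refine integral_eq_zero_of_ae (ae_of_all _ fun p => ?_)
  have := h.trace_eq_zero hT p.1.2 p.2
  simp [Matrix.one_apply, ← Finset.mul_sum, this]

/-- Since `B` is symmetric, it does not see antisymmetric fields. These supply the directions that
the cone of symmetric matrices misses. -/
theorem antisymm_mem_smoothAnnihilator (m : C(SpaceTime d T, Matrix (Fin d) (Fin d) ℝ))
    (hm : ∀ p i j, m p i j = - m p j i) :
    (((0 : C(SpaceTime d T, Fin d → ℝ)), m) : _ × _) ∈ smoothAnnihilator d T := by
  intro E B h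
  refine integral_eq_zero_of_ae (ae_of_all _ fun p => ?_)
  have h1 : ∑ i, ∑ j, m p i j * B i j p.1 p.2 = - ∑ i, ∑ j, m p i j * B i j p.1 p.2 := by
    conv_lhs => rw [Finset.sum_comm]
    simp only [← Finset.sum_neg_distrib]
    refine Finset.sum_congr rfl fun i _ => Finset.sum_congr rfl fun j _ => ?_
    rw [hm, h.symm j i _ p.1.2, neg_mul]
  simp
  linarith

end Annihilator

/-! ### Trigonometric modes and the symbol of `L`. -/

section Modes

variable {d : ℕ} {T : ℝ}

/-- The real trigonometric function `x ↦ Re (z e^{2πi k·x})`. -/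
def mode (k : Fin d → ℤ) (z : ℂ) : C(Box d, ℝ) where
  toFun x := (z * UnitAddTorus.mFourier k x).re
  continuous_toFun := by fun_prop

theorem mode_apply (k : Fin d → ℤ) (z : ℂ) (x : Box d) :
    mode k z x = (z * UnitAddTorus.mFourier k x).re := rfl

theorem mFourier_cover (k : Fin d → ℤ) (y : Fin d → ℝ) :
    UnitAddTorus.mFourier k (cover y) =
      Complex.exp (2 * Real.pi * Complex.I * ((∑ i, k i * y i : ℝ) : ℂ)) := by
  simp only [UnitAddTorus.mFourier, ContinuousMap.coe_mk, cover]
  push_cast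
  rw [Finset.mul_sum, Complex.exp_sum]
  refine Finset.prod_congr rfl fun i _ => ?_
  rw [fourier_coe_apply]
  congr 1
  push_cast
  ring

theorem mode_neg (k : Fin d → ℤ) (z : ℂ) : mode k (-z) = - mode k z := by
  ext x; simp [mode_apply]

theorem smoothOnBox_mode (k : Fin d → ℤ) (z : ℂ) : SmoothOnBox (mode k z) := by
  unfold SmoothOnBox
  simp only [mode_apply, mFourier_cover]
  refine Complex.reCLM.contDiff.comp (contDiff_const.mul (ContDiff.cexp (contDiff_const.mul ?_)))
  have h : ContDiff ℝ ∞ (fun y : Fin d → ℝ => ∑ i, (k i : ℝ) * y i) :=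
    ContDiff.sum fun i _ => contDiff_const.mul (contDiff_apply ℝ ℝ i)
  exact Complex.ofRealCLM.contDiff.comp h

/-- Differentiating `e^{2πi k·x}` multiplies it by `2πi kᵢ`; the factor `i` is absorbed in the
coefficient `z`, which keeps everything real-valued. -/
theorem pderiv_mode (k : Fin d → ℤ) (z : ℂ) (i : Fin d) :
    pderiv i (mode k z) = fun x => 2 * Real.pi * k i * mode k (Complex.I * z) x := by
  ext x
  obtain ⟨y, rfl⟩ := isOpenQuotientMap_cover.surjective x
  set S : ℝ := ∑ j, k j * y j
  have h1 : HasDerivAt (fun s : ℝ => 2 * Real.pi * Complex.I * ((S + k i * s : ℝ) : ℂ))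
      (2 * Real.pi * Complex.I * (k i : ℝ)) 0 := by
    refine HasDerivAt.const_mul _ (HasDerivAt.ofReal_comp ?_)
    simpa using ((hasDerivAt_id (0 : ℝ)).const_mul (k i : ℝ)).const_add S
  have h2 := Complex.reCLM.hasFDerivAt.comp_hasDerivAt (0 : ℝ) (h1.cexp.const_mul z)
  have h3 : (fun s : ℝ => mode k z (cover y + cover (Pi.single i s))) = Complex.reCLM ∘ fun s : ℝ =>
      z * Complex.exp (2 * Real.pi * Complex.I * ((S + k i * s : ℝ) : ℂ)) := by
    ext s
    rw [← cover_add, mode_apply, mFourier_cover]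
    simp [mul_add, Finset.sum_add_distrib, Pi.single_apply, S]
  unfold pderiv
  rw [h3, h2.deriv, mode_apply, mFourier_cover]
  simp only [mul_zero, add_zero, Complex.reCLM_apply]
  rw [← Complex.re_ofReal_mul]
  change _ = (_ * (_ * Complex.exp (2 * Real.pi * Complex.I * (S : ℂ)))).re
  congr 1
  push_cast
  ring

theorem pderiv_pderiv_mode (k : Fin d → ℤ) (z : ℂ) (i j : Fin d) :
    pderiv i (pderiv j (mode k z)) = fun x => -(4 * Real.pi ^ 2 * (k i * k j)) * mode k z x := by
  rw [pderiv_mode, pderiv_const_mul (smoothOnBox_mode _ _), pderiv_mode]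
  ext x
  simp only [← mul_assoc Complex.I, Complex.I_mul_I, neg_one_mul, mode_neg, ContinuousMap.neg_apply]
  ring

theorem integral_mode {k : Fin d → ℤ} (hk : k ≠ 0) (z : ℂ) : ∫ x, mode k z x = 0 := by
  obtain ⟨i, hi⟩ := Function.ne_iff.1 hk
  have h := integral_pderiv (smoothOnBox_mode k (-Complex.I * z)) i
  rw [pderiv_mode, integral_const_mul, ← mul_assoc, mul_neg, Complex.I_mul_I, neg_neg, one_mul] at h
  refine (mul_eq_zero.1 h).resolve_left ?_
  have : (k i : ℝ) ≠ 0 := by exact_mod_cast hi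
  positivity

/-- The squared length of a frequency. -/
def normSqFreq (k : Fin d → ℤ) : ℝ := ∑ i, (k i : ℝ) ^ 2

/-- A mode is an eigenfunction of `-Δ` with eigenvalue `4π²|k|²`. At `k = 0` the hypothesis forces
`c = 0`, and division by zero then gives the correct value `0`. -/
theorem isInvNegLaplacian_mode (k : Fin d → ℤ) (z : ℂ) {c : ℝ} (hc : k = 0 → c = 0) :
    IsInvNegLaplacian (fun x => c / (4 * Real.pi ^ 2 * normSqFreq k) * mode k z x)
      (fun x => c * mode k z x) := by
  have hs := smoothOnBox_mode k z
  refine ⟨hs.const_mul _, ?_, fun x => ?_⟩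
  · rw [integral_const_mul]
    by_cases hk : k = 0
    · simp [hc hk]
    · rw [integral_mode hk, mul_zero]
  · have h : ∀ i, pderiv i (pderiv i fun x => c / (4 * Real.pi ^ 2 * normSqFreq k) * mode k z x) x =
        - (c / (4 * Real.pi ^ 2 * normSqFreq k) * (4 * Real.pi ^ 2) * mode k z x * (k i : ℝ) ^ 2) := by
      intro i
      rw [pderiv_const_mul hs, pderiv_const_mul (hs.pderiv i), pderiv_pderiv_mode]
      ring
    simp only [h, Finset.sum_neg_distrib, neg_neg, ← Finset.mul_sum]
    rw [← normSqFreq]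
    by_cases hk : k = 0
    · simp [hc hk]
    · have : normSqFreq k ≠ 0 := by
        obtain ⟨i, hi⟩ := Function.ne_iff.1 hk
        have : (k i : ℝ) ≠ 0 := by exact_mod_cast hi
        refine ne_of_gt (Finset.sum_pos' (fun _ _ => sq_nonneg _) ⟨i, Finset.mem_univ _, by positivity⟩)
      have := Real.pi_ne_zero
      field_simp

/-- The symbol of the operator `L` at frequency `k`, up to the factor `i`. -/
def symb (k : Fin d → ℤ) (i j p : Fin d) : ℝ :=
  2 * Real.pi * (((if i = p then (k j : ℝ) else 0) + (if j = p then (k i : ℝ) else 0)) / 2 -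
    k i * k j * k p / normSqFreq k)

theorem symb_comm (k : Fin d → ℤ) (i j p : Fin d) : symb k i j p = symb k j i p := by
  unfold symb; ring

theorem SmoothOnBox.smoothOnSpaceTime_mul {f : Box d → ℝ} (hf : SmoothOnBox f) {w : ℝ → ℝ}
    (hw : ContDiff ℝ ∞ w) : SmoothOnSpaceTime T (fun t x => w t * f x) :=
  ((hw.comp contDiff_fst).mul (ContDiff.comp hf contDiff_snd)).contDiffOn

/-- Single-mode members of the smooth class: `W` is the time factor of `B`, so `W T = 0` is the
terminal condition and `deriv W` must be the factor of `E`. -/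
theorem isSmoothEB_mode (hT : 0 < T) (k : Fin d → ℤ) (z : ℂ) (p : Fin d) {W : ℝ → ℝ}
    (hW : ContDiff ℝ ∞ W) (hWT : W T = 0) :
    IsSmoothEB T (fun i t x => deriv W t * ((if i = p then 1 else 0) * mode k z x))
      (fun i j t x => W t * (symb k i j p * mode k (Complex.I * z) x)) := by
  have hW' : ContDiff ℝ ∞ (deriv W) := ContDiff.deriv' (by simpa using hW)
  have hs : ∀ w, SmoothOnBox (mode k w) := smoothOnBox_mode k
  have hpE : ∀ i j t, pderiv j (fun x => deriv W t * ((if i = p then 1 else 0) * mode k z x)) =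
      fun x => deriv W t * ((if i = p then 1 else 0) *
        (2 * Real.pi * k j * mode k (Complex.I * z) x)) := by
    intro i j t
    rw [pderiv_const_mul ((hs z).const_mul _), pderiv_const_mul (hs z), pderiv_mode]
  refine ⟨fun i => ((hs z).const_mul _).smoothOnSpaceTime_mul hW',
    fun i j => ((hs _).const_mul _).smoothOnSpaceTime_mul hW, ?_, ?_, ?_⟩
  · intro i j t _ x
    rw [symb_comm]
  · intro i j x
    rw [hWT, zero_mul]
  · intro t ht
    have h := isInvNegLaplacian_mode k (Complex.I * z) (c := deriv W t * (2 * Real.pi * k p))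
      (fun hk => by simp [hk])
    refine ⟨fun x => deriv W t * (2 * Real.pi * k p) / (4 * Real.pi ^ 2 * normSqFreq k) *
      mode k (Complex.I * z) x, ?_, fun i j x => ?_⟩
    · convert h using 1
      ext x
      simp only [hpE]
      simp [mul_assoc]
    · have hd : HasDerivAt (fun s => W s * (symb k i j p * mode k (Complex.I * z) x))
          (deriv W t * (symb k i j p * mode k (Complex.I * z) x)) t :=
        ((hW.differentiable (by simp)) t).hasDerivAt.mul_const _
      rw [hd.hasDerivWithinAt.derivWithin (uniqueDiffOn_Icc hT t ht), hpE, hpE,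
        pderiv_const_mul (hs _), pderiv_const_mul ((hs _).pderiv j), pderiv_pderiv_mode]
      have : (0 : ℝ) < 4 * Real.pi ^ 2 := by positivity
      have e : deriv W t * (2 * Real.pi * k p) / (4 * Real.pi ^ 2 * normSqFreq k) *
          (-(4 * Real.pi ^ 2 * (k i * k j)) * mode k (Complex.I * z) x) =
          -(deriv W t * (2 * Real.pi * (k i * k j * k p / normSqFreq k)) *
            mode k (Complex.I * z) x) := by
        rw [div_mul_eq_mul_div, ← mul_div_mul_left _ (normSqFreq k) this.ne', ← mul_div_assoc,
          ← mul_div_assoc, div_mul_eq_mul_div, ← neg_div]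
        congr 1
        ring
      beta_reduce
      rw [e, symb]
      split_ifs <;> ring

/-- The symmetric matrix `(e_a ⊗ e_b + e_b ⊗ e_a) / 2`. -/
def symUnit (a b i j : Fin d) : ℝ :=
  ((if i = a then if j = b then 1 else 0 else 0) + (if i = b then if j = a then 1 else 0 else 0)) / 2

theorem sum_symUnit (a b : Fin d) (F : Fin d → Fin d → ℝ) :
    ∑ i, ∑ j, symUnit a b i j * F i j = (F a b + F b a) / 2 := by
  simp only [symUnit, add_div, add_mul, Finset.sum_add_distrib]
  have h : ∀ a b, ∑ i, ∑ j, (if i = a then if j = b then (1 : ℝ) else 0 else 0) / 2 * F i j =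
      F a b / 2 := by
    intro a b
    rw [Finset.sum_eq_single a (fun i _ hi => by simp [hi]) (by simp),
      Finset.sum_eq_single b (fun i _ hi => by simp [hi]) (by simp)]
    simp; ring
  rw [h, h]

theorem sum_symUnit_right (a b p : Fin d) (F : Fin d → ℝ) :
    ∑ j, symUnit a b p j * F j =
      ((if a = p then F b else 0) + (if b = p then F a else 0)) / 2 := by
  simp only [symUnit, add_div, add_mul, Finset.sum_add_distrib]
  have h : ∀ a b, ∑ j, (if p = a then if j = b then (1 : ℝ) else 0 else 0) / 2 * F j =
      (if a = p then F b else 0) / 2 := by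
    intro a b
    rw [Finset.sum_eq_single b (fun i _ hi => by simp [hi]) (by simp)]
    by_cases h : p = a
    · simp [h]; ring
    · simp [h, Ne.symm h]
  rw [h, h]

theorem symUnit_comm (a b i j : Fin d) : symUnit a b i j = symUnit a b j i := by
  unfold symUnit
  split_ifs <;> simp

/-- The constraint of `ℰℬ`, tested against one trigonometric mode. -/
theorem IsEB.mode_eq {E : Fin d → SignedMeasure (SpaceTime d T)}
    {B : Fin d → Fin d → SignedMeasure (SpaceTime d T)} (h : IsEB T E B) (k : Fin d → ℤ) (w : ℂ)
    (a b : Fin d) {ζ : ℝ → ℝ} (hζ : ContDiffOn ℝ ∞ ζ (Icc 0 T)) (hζ0 : ζ 0 = 0) :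
    ∫ᵛ p, derivWithin ζ (Icc 0 T) (p.1 : ℝ) * mode k w p.2 ∂•(B a b) =
      ∑ p, symb k a b p * ∫ᵛ x, ζ (x.1 : ℝ) * mode k (Complex.I * w) x.2 ∂•(E p) := by
  have hs : ∀ w, SmoothOnBox (mode k w) := smoothOnBox_mode k
  have hq := isInvNegLaplacian_mode k w (c := -(4 * Real.pi ^ 2 * (k a * k b)))
      (fun hk => by simp [hk])
  have hdiv : ∀ i j, pderiv i (pderiv j fun x => symUnit a b i j * mode k w x) =
      fun x => symUnit a b i j * (-(4 * Real.pi ^ 2 * (k i * k j)) * mode k w x) := by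
    intro i j
    rw [pderiv_const_mul (hs w), pderiv_const_mul ((hs w).pderiv j), pderiv_pderiv_mode]
  have hdiv2 : (fun x => ∑ i, ∑ j, pderiv i (pderiv j fun x => symUnit a b i j * mode k w x) x) =
      fun x => -(4 * Real.pi ^ 2 * (k a * k b)) * mode k w x := by
    ext x
    simp only [hdiv]
    rw [sum_symUnit]
    ring
  -- The field `symUnit a b` times a mode isolates the entry `B a b`; the symmetry of `B` merges the
  -- two entries it meets.
  have := h.weak ζ (fun i j x => symUnit a b i j * mode k w x) _ hζ hζ0
    (fun i j => (hs w).const_mul _) (fun i j => by simp only [symUnit_comm a b i j])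
    (by rw [hdiv2]; exact hq)
  rw [sub_eq_zero] at this
  have hl : ∀ i j, ∫ᵛ p, derivWithin ζ (Icc 0 T) (p.1 : ℝ) * (symUnit a b i j * mode k w p.2)
      ∂•(B i j) = symUnit a b i j * ∫ᵛ p, derivWithin ζ (Icc 0 T) (p.1 : ℝ) * mode k w p.2 ∂•(B i j) := by
    intro i j
    rw [← smul_eq_mul (symUnit a b i j), ← VectorMeasure.integral_fun_smul]
    congr 1; ext p
    simp only [smul_eq_mul]
    ring
  simp only [hl] at this
  rw [sum_symUnit a b fun i j => ∫ᵛ p, derivWithin ζ (Icc 0 T) (p.1 : ℝ) * mode k w p.2 ∂•(B i j),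
    h.symm b a, add_self_div_two] at this
  rw [this]
  refine Finset.sum_congr rfl fun p _ => ?_
  rw [← smul_eq_mul (symb k a b p), ← VectorMeasure.integral_fun_smul]
  congr 1; ext x
  have h1 : ∑ j, pderiv j (fun x => symUnit a b p j * mode k w x) x.2 =
      ((if a = p then (k b : ℝ) else 0) + (if b = p then (k a : ℝ) else 0)) / 2 *
        (2 * Real.pi * mode k (Complex.I * w) x.2) := by
    have : ∀ j, pderiv j (fun x => symUnit a b p j * mode k w x) x.2 =
        symUnit a b p j * k j * (2 * Real.pi * mode k (Complex.I * w) x.2) := by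
      intro j
      rw [pderiv_const_mul (hs w), pderiv_mode]
      ring
    simp only [this, ← Finset.sum_mul]
    rw [sum_symUnit_right a b p fun j => (k j : ℝ)]
  rw [h1, pderiv_const_mul (hs w), pderiv_mode, symb, smul_eq_mul, neg_div,
    mul_div_mul_left _ _ (by positivity : (4 * Real.pi ^ 2 : ℝ) ≠ 0)]
  ring

end Modes

/-! ### Time dependence at a fixed frequency. -/

section TimeFunctionals

variable {d : ℕ} {T : ℝ}

/-- Lebesgue measure on `[0,T]`. -/
abbrev timeMeasure (T : ℝ) : Measure (Icc (0 : ℝ) T) :=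
  Measure.comap (fun t : Icc (0 : ℝ) T => (t : ℝ)) volume

theorem integrable_time (f : C(Icc (0 : ℝ) T, ℝ)) : Integrable f (timeMeasure T) :=
  integrable_continuousMap _ f

theorem clm_eq_zero_of_polynomial (L : C(Icc (0 : ℝ) T, ℝ) →L[ℝ] ℝ)
    (h : ∀ P : Polynomial ℝ, L (P.toContinuousMapOn (Icc 0 T)) = 0) : L = 0 := by
  ext f
  by_contra hne
  have hpos : 0 < |L f| := abs_pos.2 hne
  obtain ⟨P, hP⟩ := exists_polynomial_near_continuousMap 0 T f (|L f| / (‖L‖ + 1)) (by positivity)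
  have h1 : L (P.toContinuousMapOn (Icc 0 T) - f) = - L f := by rw [map_sub, h, zero_sub]
  have h2 := L.le_opNorm (P.toContinuousMapOn (Icc 0 T) - f)
  rw [h1, norm_neg, Real.norm_eq_abs] at h2
  rw [lt_div_iff₀ (by positivity)] at hP
  nlinarith [norm_nonneg (P.toContinuousMapOn (Icc 0 T) - f)]

theorem continuousMap_eq_zero_of_integral_sq (hT : 0 < T) (f : C(Icc (0 : ℝ) T, ℝ))
    (h : ∫ t, f t * f t ∂(timeMeasure T) = 0) : f = 0 := by
  let F := IccExtend hT.le f
  have hF : Continuous F := f.continuous.Icc_extend'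
  have hFf : ∀ t : Icc (0 : ℝ) T, F t = f t := fun t => IccExtend_val hT.le f t
  have h1 : ∫ t in Icc 0 T, F t * F t = 0 := by
    have := integral_subtype_comap (μ := volume) (measurableSet_Icc (a := 0) (b := T))
      (fun t => F t * F t)
    simp only [hFf] at this
    exact this.symm.trans h
  rw [setIntegral_eq_zero_iff_of_nonneg_ae (ae_of_all _ fun t => mul_self_nonneg _)
    ((hF.mul hF).integrableOn_Icc)] at h1
  have h2 := Measure.eqOn_Icc_of_ae_eq volume hT.ne h1 (hF.mul hF).continuousOn continuousOn_const
  ext t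
  have := h2 t.2
  simpa [hFf] using this

/-- The primitive vanishing at time `0`. -/
def primitive (hT : 0 < T) : C(Icc (0 : ℝ) T, ℝ) →L[ℝ] C(Icc (0 : ℝ) T, ℝ) :=
  LinearMap.mkContinuous
    { toFun := fun n => ⟨fun t => ∫ s in (0 : ℝ)..t, IccExtend hT.le n s,
        (intervalIntegral.continuous_primitive
          (fun a b => (n.continuous.Icc_extend').intervalIntegrable a b) 0).comp
            continuous_subtype_val⟩
      map_add' := fun n m => by
        ext t
        exact intervalIntegral.integral_add (n.continuous.Icc_extend'.intervalIntegrable _ _)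
          (m.continuous.Icc_extend'.intervalIntegrable _ _)
      map_smul' := fun c n => by
        ext t
        exact intervalIntegral.integral_smul c _ } T
    (fun n => by
      refine (ContinuousMap.norm_le _ (by positivity)).2 fun t => ?_
      have := intervalIntegral.norm_integral_le_of_norm_le_const (a := 0) (b := t) (C := ‖n‖)
        (f := IccExtend hT.le n) (fun s _ => n.norm_coe_le_norm _)
      refine this.trans ?_
      rw [sub_zero, abs_of_nonneg t.2.1, mul_comm]
      exact mul_le_mul_of_nonneg_right t.2.2 (norm_nonneg _))

theorem primitive_apply (hT : 0 < T) (n : C(Icc (0 : ℝ) T, ℝ)) (t : Icc (0 : ℝ) T) :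
    primitive hT n t = ∫ s in (0 : ℝ)..t, IccExtend hT.le n s := rfl

/-- Integration by parts against `W = ∫_T P`. -/
theorem integral_mul_primitive (hT : 0 < T) (n : C(Icc (0 : ℝ) T, ℝ)) {W : ℝ → ℝ}
    (hW : ContDiff ℝ 1 W) (hWT : W T = 0) :
    ∫ t, W t * n t ∂(timeMeasure T) = - ∫ t, deriv W t * primitive hT n t ∂(timeMeasure T) := by
  let F := IccExtend hT.le n
  have hF : Continuous F := n.continuous.Icc_extend'
  have hFn : ∀ t : Icc (0 : ℝ) T, F t = n t := fun t => IccExtend_val hT.le n t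
  have h := intervalIntegral.integral_mul_deriv_eq_deriv_mul (a := 0) (b := T) (u := W)
    (v := fun t => ∫ s in (0 : ℝ)..t, F s) (u' := deriv W) (v' := F)
    (fun x _ => ((hW.differentiable (by simp)) x).hasDerivAt)
    (fun x _ => intervalIntegral.integral_hasDerivAt_right (hF.intervalIntegrable _ _)
      (hF.stronglyMeasurableAtFilter _ _) hF.continuousAt)
    ((hW.continuous_deriv le_rfl).intervalIntegrable _ _) (hF.intervalIntegrable _ _)
  simp only [hWT, intervalIntegral.integral_same, mul_zero, zero_mul, sub_self, zero_sub] at h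
  rw [← integral_time hT.le, ← integral_time hT.le] at h
  simp only [hFn] at h
  exact h

/-- The product `n(t) f(x)`. -/
def tensor (f : C(Box d, ℝ)) : C(Icc (0 : ℝ) T, ℝ) →L[ℝ] C(SpaceTime d T, ℝ) :=
  LinearMap.mkContinuous
    { toFun := fun n => ⟨fun p => n p.1 * f p.2, by fun_prop⟩
      map_add' := fun n m => by ext p; simp [add_mul]
      map_smul' := fun c n => by ext p; simp [mul_assoc] } ‖f‖
    (fun n => by
      refine (ContinuousMap.norm_le _ (by positivity)).2 fun p => ?_
      refine (norm_mul_le _ _).trans ?_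
      rw [mul_comm]
      exact mul_le_mul (f.norm_coe_le_norm _) (n.norm_coe_le_norm _) (norm_nonneg _) (norm_nonneg _))

theorem tensor_apply (f : C(Box d, ℝ)) (n : C(Icc (0 : ℝ) T, ℝ)) (p : SpaceTime d T) :
    tensor f n p = n p.1 * f p.2 := rfl

/-- The free base point `c` serves both constraints: `c = 0` for the test function `ζ`, and `c = T`
for the time factor of `B`. -/
theorem exists_polynomial_antiderivative (P : Polynomial ℝ) (c : ℝ) :
    ∃ W : ℝ → ℝ, ContDiff ℝ ∞ W ∧ deriv W = (fun t => P.eval t) ∧ W c = 0 := by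
  have hP : Continuous fun t => P.eval t := P.continuous
  have hd : ∀ t, HasDerivAt (fun t => ∫ s in c..t, P.eval s) (P.eval t) t := fun t =>
    intervalIntegral.integral_hasDerivAt_right (hP.intervalIntegrable _ _)
      (hP.stronglyMeasurableAtFilter _ _) hP.continuousAt
  have hderiv : deriv (fun t => ∫ s in c..t, P.eval s) = fun t => P.eval t :=
    funext fun t => (hd t).deriv
  refine ⟨fun t => ∫ s in c..t, P.eval s, ?_, hderiv, intervalIntegral.integral_same⟩
  rw [contDiff_infty_iff_deriv]
  exact ⟨fun t => (hd t).differentiableAt, by rw [hderiv]; exact P.contDiff_aeval _⟩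

/-- For `n = ζ'` with `ζ(0) = 0` this is the weak constraint on one mode. Both sides are continuous
in `n`, and polynomials are dense, so it holds for every continuous `n`. -/
theorem pairing_tensor_mode_eq (hT : 0 < T) {E : Fin d → SignedMeasure (SpaceTime d T)}
    {B : Fin d → Fin d → SignedMeasure (SpaceTime d T)} (h : IsEB T E B) (k : Fin d → ℤ) (w : ℂ)
    (a b : Fin d) (n : C(Icc (0 : ℝ) T, ℝ)) :
    pairing (B a b) (tensor (mode k w) n) =
      ∑ p, symb k a b p * pairing (E p) (tensor (mode k (Complex.I * w)) (primitive hT n)) := by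
  let L : C(Icc (0 : ℝ) T, ℝ) →L[ℝ] ℝ := (pairing (B a b)).comp (tensor (mode k w)) -
    ∑ p, symb k a b p • (pairing (E p)).comp ((tensor (mode k (Complex.I * w))).comp (primitive hT))
  have hL : L = 0 := by
    refine clm_eq_zero_of_polynomial L fun P => ?_
    obtain ⟨W, hW, hWd, hW0⟩ := exists_polynomial_antiderivative P 0
    have hWI : ∀ t : Icc (0 : ℝ) T, derivWithin W (Icc 0 T) t = P.eval (t : ℝ) := fun t => by
      rw [((hW.differentiable (by simp)) t).derivWithin (uniqueDiffOn_Icc hT t t.2), hWd]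
    have hprim : ∀ t : Icc (0 : ℝ) T,
        primitive hT (P.toContinuousMapOn (Icc 0 T)) t = W t := fun t => by
      rw [primitive_apply]
      have : ∀ s ∈ uIcc (0 : ℝ) t, IccExtend hT.le (P.toContinuousMapOn (Icc 0 T)) s = deriv W s := by
        intro s hs
        rw [uIcc_of_le t.2.1] at hs
        rw [IccExtend_of_mem hT.le _ ⟨hs.1, hs.2.trans t.2.2⟩, hWd]
        rfl
      rw [intervalIntegral.integral_congr this, intervalIntegral.integral_deriv_eq_sub
        (fun s _ => (hW.differentiable (by simp)) s)
        ((hW.continuous_deriv (by simp)).intervalIntegrable _ _), hW0, sub_zero]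
    have := h.mode_eq k w a b hW.contDiffOn hW0
    simp only [L, sub_apply, sum_apply,
      smul_apply, ContinuousLinearMap.comp_apply, pairing_apply, tensor_apply,
      hprim, smul_eq_mul]
    simp only [hWI] at this
    rw [sub_eq_zero]
    exact this
  have := DFunLike.congr_fun hL n
  simpa [L, sub_eq_zero] using this

/-- The coefficient `t ↦ ∫ f(t,x) Re (z e^{2πi k·x}) dx`. -/
def coef (f : C(SpaceTime d T, ℝ)) (k : Fin d → ℤ) (z : ℂ) : C(Icc (0 : ℝ) T, ℝ) where
  toFun t := ∫ x, f (t, x) * mode k z x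
  continuous_toFun := by
    refine continuous_of_dominated (bound := fun _ => ‖f‖ * ‖mode k z‖)
      (fun t => (Continuous.aestronglyMeasurable (by fun_prop)))
      (fun t => ae_of_all _ fun x => ?_) (integrable_const _) (ae_of_all _ fun x => by fun_prop)
    exact (norm_mul_le _ _).trans
      (mul_le_mul (f.norm_coe_le_norm _) ((mode k z).norm_coe_le_norm _) (norm_nonneg _)
        (norm_nonneg _))

theorem coef_apply (f : C(SpaceTime d T, ℝ)) (k : Fin d → ℤ) (z : ℂ) (t : Icc (0 : ℝ) T) :
    coef f k z t = ∫ x, f (t, x) * mode k z x := rfl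

theorem coef_neg (f : C(SpaceTime d T, ℝ)) (k : Fin d → ℤ) (z : ℂ) :
    coef f k (-z) = - coef f k z := by
  ext t
  simp [coef_apply, mode_neg, integral_neg]

/-- The `p`-th component of a continuous vector field. -/
def component (z : C(SpaceTime d T, Fin d → ℝ)) (p : Fin d) : C(SpaceTime d T, ℝ) :=
  ⟨fun x => z x p, continuous_component z p⟩

/-- An entry of a continuous matrix field. -/
def entry (m : C(SpaceTime d T, Matrix (Fin d) (Fin d) ℝ)) (i j : Fin d) : C(SpaceTime d T, ℝ) :=
  ⟨fun x => m x i j, continuous_entry m i j⟩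

theorem component_apply (z : C(SpaceTime d T, Fin d → ℝ)) (p : Fin d) (x : SpaceTime d T) :
    component z p x = z x p := rfl

theorem entry_apply (m : C(SpaceTime d T, Matrix (Fin d) (Fin d) ℝ)) (i j : Fin d)
    (x : SpaceTime d T) : entry m i j x = m x i j := rfl

theorem eq_zero_of_integral_polynomial_mul (hT : 0 < T) (r : C(Icc (0 : ℝ) T, ℝ))
    (h : ∀ P : Polynomial ℝ, ∫ t : Icc (0 : ℝ) T, P.eval (t : ℝ) * r t ∂(timeMeasure T) = 0) :
    r = 0 := by
  let L : C(Icc (0 : ℝ) T, ℝ) →L[ℝ] ℝ := LinearMap.mkContinuous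
    { toFun := fun u => ∫ t, u t * r t ∂(timeMeasure T)
      map_add' := fun u v => by
        simp only [ContinuousMap.add_apply, add_mul]
        exact integral_add (integrable_time (u * r)) (integrable_time (v * r))
      map_smul' := fun c u => by
        simp only [ContinuousMap.smul_apply, smul_eq_mul, mul_assoc, integral_const_mul,
          RingHom.id_apply] } (‖r‖ * (timeMeasure T).real univ)
    (fun u => by
      refine (norm_integral_le_of_norm_le_const (C := ‖u‖ * ‖r‖) (ae_of_all _ fun t => ?_)).trans
        (le_of_eq (by ring))
      exact (norm_mul_le _ _).trans (mul_le_mul (u.norm_coe_le_norm _) (r.norm_coe_le_norm _)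
        (norm_nonneg _) (norm_nonneg _)))
  have hL : L = 0 := clm_eq_zero_of_polynomial L h
  have h1 : L r = 0 := by rw [hL]; rfl
  exact continuousMap_eq_zero_of_integral_sq hT r h1

theorem integral_mode_integrand (z : C(SpaceTime d T, Fin d → ℝ))
    (m : C(SpaceTime d T, Matrix (Fin d) (Fin d) ℝ)) (k : Fin d → ℤ) (w w' : ℂ) (p : Fin d)
    (S : Fin d → Fin d → ℝ) (α β : ℝ) (t : Icc (0 : ℝ) T) :
    ∫ x, ((∑ i, ∑ j, m (t, x) i j * (α * (S i j * mode k w' x))) +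
        ∑ i, z (t, x) i * (β * ((if i = p then 1 else 0) * mode k w x))) =
      α * (∑ i, ∑ j, S i j * coef (entry m i j) k w' t) + β * coef (component z p) k w t := by
  have cm : ∀ i j, Continuous (fun x => m (t, x) i j * mode k w' x) := fun i j =>
    ((continuous_entry m i j).comp (by fun_prop : Continuous fun x : Box d => (t, x))).mul
      (mode k w').continuous
  have hm : ∀ i j, Integrable (fun x => α * (S i j * (m (t, x) i j * mode k w' x))) :=
    fun i j => ((integrable_box (cm i j)).const_mul _).const_mul _
  have cz : Continuous (fun x => z (t, x) p * mode k w x) :=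
    ((continuous_component z p).comp (by fun_prop : Continuous fun x : Box d => (t, x))).mul
      (mode k w).continuous
  have e : ∀ x, (∑ i, ∑ j, m (t, x) i j * (α * (S i j * mode k w' x))) +
      ∑ i, z (t, x) i * (β * ((if i = p then 1 else 0) * mode k w x)) =
      (∑ i, ∑ j, α * (S i j * (m (t, x) i j * mode k w' x))) +
        β * (z (t, x) p * mode k w x) := by
    intro x
    congr 1
    · refine Finset.sum_congr rfl fun i _ => Finset.sum_congr rfl fun j _ => ?_
      ring
    · rw [Finset.sum_eq_single p (fun i _ hi => by simp [hi]) (by simp), if_pos rfl]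
      ring
  simp only [e]
  rw [integral_add (integrable_finsetSum _ fun i _ => integrable_finsetSum _ fun j _ => hm i j)
    ((integrable_box cz).const_mul _), integral_const_mul,
    integral_finsetSum _ fun i _ => integrable_finsetSum _ fun j _ => hm i j]
  congr 1
  rw [Finset.mul_sum]
  refine Finset.sum_congr rfl fun i _ => ?_
  rw [integral_finsetSum _ fun j _ => hm i j, Finset.mul_sum]
  refine Finset.sum_congr rfl fun j _ => ?_
  rw [integral_const_mul, integral_const_mul]
  rfl

/-- The counterpart of `pairing_tensor_mode_eq` for the annihilator, with the same symbol. Testing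
against single-mode smooth pairs gives `∫ W n + W' g = 0`; integration by parts makes `g - primitive
n` orthogonal to all polynomials `W'`. -/
theorem coef_eq_of_mem_smoothAnnihilator (hT : 0 < T) {z : C(SpaceTime d T, Fin d → ℝ)}
    {m : C(SpaceTime d T, Matrix (Fin d) (Fin d) ℝ)} (h : (z, m) ∈ smoothAnnihilator d T)
    (k : Fin d → ℤ) (w : ℂ) (p : Fin d) :
    coef (component z p) k w =
      ∑ i, ∑ j, symb k i j p • primitive hT (coef (entry m i j) k (Complex.I * w)) := by
  set n : C(Icc (0 : ℝ) T, ℝ) := ∑ i, ∑ j, symb k i j p • coef (entry m i j) k (Complex.I * w)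
    with hn
  have hprim : primitive hT n =
      ∑ i, ∑ j, symb k i j p • primitive hT (coef (entry m i j) k (Complex.I * w)) := by
    simp only [hn, map_sum, map_smul]
  have hnt : ∀ t, ∑ i, ∑ j, symb k i j p * coef (entry m i j) k (Complex.I * w) t = n t := by
    intro t
    simp only [hn, ContinuousMap.sum_apply, ContinuousMap.smul_apply, smul_eq_mul]
  rw [← hprim, ← sub_eq_zero]
  generalize hg : coef (component z p) k w = g
  clear_value n
  refine eq_zero_of_integral_polynomial_mul hT _ fun P => ?_
  obtain ⟨W, hW, hWd, hWT⟩ := exists_polynomial_antiderivative P T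
  have hEB := isSmoothEB_mode hT k w p hW hWT
  have h0 := h _ _ hEB
  rw [integral_leb (hEB.continuous_integrand z m)] at h0
  have hW' : Continuous (deriv W) := hW.continuous_deriv (by simp)
  simp only [integral_mode_integrand, hnt, hg] at h0
  let Wc : C(Icc (0 : ℝ) T, ℝ) := ⟨fun t => W t, hW.continuous.comp continuous_subtype_val⟩
  let Wd : C(Icc (0 : ℝ) T, ℝ) := ⟨fun t => deriv W t, hW'.comp continuous_subtype_val⟩
  have i1 : Integrable (fun t : Icc (0 : ℝ) T => W t * n t) (timeMeasure T) :=
    integrable_time (Wc * n)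
  have i2 : Integrable (fun t : Icc (0 : ℝ) T => deriv W t * g t) (timeMeasure T) :=
    integrable_time (Wd * g)
  have i3 : Integrable (fun t : Icc (0 : ℝ) T => deriv W t * primitive hT n t) (timeMeasure T) :=
    integrable_time (Wd * primitive hT n)
  rw [integral_add i1 i2, integral_mul_primitive hT n (hW.of_le (by simp)) hWT, neg_add_eq_sub,
    ← integral_sub i2 i3] at h0
  refine Eq.trans (integral_congr_ae (ae_of_all _ fun t => ?_)) h0
  simp only [ContinuousMap.sub_apply, mul_sub, hWd]

end TimeFunctionals

/-! ### Translations: from smooth pairs to measures in `ℰℬ`. -/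

section Shift

variable {d : ℕ} {T : ℝ}

theorem mFourier_sub (k : Fin d → ℤ) (x y : Box d) :
    UnitAddTorus.mFourier k (x - y) =
      UnitAddTorus.mFourier k x * (starRingEnd ℂ) (UnitAddTorus.mFourier k y) := by
  simp only [UnitAddTorus.mFourier, ContinuousMap.coe_mk, map_prod, ← Finset.prod_mul_distrib]
  refine Finset.prod_congr rfl fun i _ => ?_
  simp [fourier_apply, sub_eq_add_neg, AddCircle.toCircle_add, AddCircle.toCircle_neg,
    ← Circle.coe_inv_eq_conj]

theorem mode_sub (k : Fin d → ℤ) (c : ℂ) (x y : Box d) :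
    mode k c (x - y) =
      mode k 1 y * mode k c x + mode k (-Complex.I) y * mode k (-(Complex.I * c)) x := by
  simp only [mode_apply, mFourier_sub]
  simp
  ring

theorem volume_box_eq :
    (volume : Measure (Box d)) = Measure.pi fun _ => AddCircle.haarAddCircle := by
  rw [volume_pi]
  congr 1; ext1 i
  rw [AddCircle.volume_eq_smul_haarAddCircle]
  simp

/-- The modes with `c = 1` and `c = -i` give the real and imaginary parts of the Fourier
coefficients. When these all vanish the Fourier series is summable, hence converges pointwise to
`f`. -/
theorem eq_zero_of_integral_mode (f : C(Box d, ℝ))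
    (h : ∀ k c, ∫ x, f x * mode k c x = 0) : f = 0 := by
  let F : C(Box d, ℂ) := ⟨fun x => (f x : ℂ), by fun_prop⟩
  have h0 : ∀ k, UnitAddTorus.mFourierCoeff F k = 0 := by
    intro k
    have e : UnitAddTorus.mFourierCoeff F k = ∫ x : Box d, UnitAddTorus.mFourier (-k) x • F x := by
      rw [volume_box_eq]; rfl
    have hint : Integrable (fun x : Box d => UnitAddTorus.mFourier (-k) x • F x) :=
      Continuous.integrable_of_hasCompactSupport (by fun_prop) (HasCompactSupport.of_compactSpace _)
    rw [e]
    apply Complex.ext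
    · rw [← RCLike.re_eq_complex_re, ← integral_re hint, map_zero, ← h (-k) 1]
      congr 1; ext x
      simp [F, mode_apply, mul_comm]
    · rw [← RCLike.im_eq_complex_im, ← integral_im hint, map_zero, ← h (-k) (-Complex.I)]
      congr 1; ext x
      simp [F, mode_apply, mul_comm]
  have h0' : UnitAddTorus.mFourierCoeff F = 0 := funext h0
  ext x
  have hs := UnitAddTorus.hasSum_mFourier_series_apply_of_summable (f := F)
    (by rw [h0']; exact summable_zero) x
  simp only [h0, zero_smul] at hs
  have := hs.unique hasSum_zero
  simpa [F] using this

instance isNegInvariant_box : (volume : Measure (Box d)).IsNegInvariant :=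
  Measure.IsAddHaarMeasure.isNegInvariant_of_regular _

/-- The translates `a ↦ ((t,x) ↦ f (t, x - a))` of a continuous function. -/
def shift (f : C(SpaceTime d T, ℝ)) : C(Box d, C(SpaceTime d T, ℝ)) :=
  ContinuousMap.curry ⟨fun q : Box d × SpaceTime d T => f (q.2.1, q.2.2 - q.1), by fun_prop⟩

theorem shift_apply (f : C(SpaceTime d T, ℝ)) (a : Box d) (p : SpaceTime d T) :
    shift f a p = f (p.1, p.2 - a) := rfl

theorem shift_zero (f : C(SpaceTime d T, ℝ)) : shift f 0 = f := by
  ext p; simp [shift_apply]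

/-- The integral over translations is a convolution with a mode. The addition formula `mode_sub`
splits it into two products of a function of time and a mode. -/
theorem integral_shift_mode (s : SignedMeasure (SpaceTime d T)) (f : C(SpaceTime d T, ℝ))
    (k : Fin d → ℤ) (c : ℂ) :
    ∫ a, pairing s (shift f a) * mode k c a =
      pairing s (tensor (mode k c) (coef f k 1)) +
        pairing s (tensor (mode k (-(Complex.I * c))) (coef f k (-Complex.I))) := by
  have hint : Integrable (fun a : Box d => mode k c a • shift f a) :=
    Continuous.integrable_of_hasCompactSupport (by fun_prop) (HasCompactSupport.of_compactSpace _)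
  have h1 : ∫ a, pairing s (shift f a) * mode k c a =
      pairing s (∫ a, mode k c a • shift f a) := by
    rw [← ContinuousLinearMap.integral_comp_comm _ hint]
    simp only [map_smul, smul_eq_mul, mul_comm]
  rw [h1, ← map_add]
  congr 1; ext p
  have h2 : (∫ a, mode k c a • shift f a) p = ∫ a, mode k c a * f (p.1, p.2 - a) :=
    ((ContinuousMap.evalCLM ℝ p).integral_comp_comm hint).symm
  have h3 := integral_sub_left_eq_self (fun y => mode k c (p.2 - y) * f (p.1, y))
    (volume : Measure (Box d)) p.2
  simp only [sub_sub_cancel] at h3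
  rw [h2, h3]
  have i1 : ∀ z, Integrable (fun y : Box d => f (p.1, y) * mode k z y) := fun z =>
    integrable_box (by fun_prop)
  simp only [mode_sub, ContinuousMap.add_apply, tensor_apply, coef_apply]
  rw [← integral_mul_const, ← integral_mul_const,
    ← integral_add ((i1 _).mul_const _) ((i1 _).mul_const _)]
  congr 1; ext y
  ring

theorem tensor_neg (f : C(Box d, ℝ)) (n : C(Icc (0 : ℝ) T, ℝ)) :
    tensor (-f) n = - tensor f n := by
  ext p; simp [tensor_apply]

/-- The constraint defining sub-solutions passes from smooth fields to measures in `ℰℬ`. -/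
theorem IsEB.pairing_eq_zero (hT : 0 < T) {E : Fin d → SignedMeasure (SpaceTime d T)}
    {B : Fin d → Fin d → SignedMeasure (SpaceTime d T)} (hEB : IsEB T E B)
    {z : C(SpaceTime d T, Fin d → ℝ)} {m : C(SpaceTime d T, Matrix (Fin d) (Fin d) ℝ)}
    (h : (z, m) ∈ smoothAnnihilator d T) :
    (∑ i, ∑ j, pairing (B i j) (entry m i j)) + ∑ p, pairing (E p) (component z p) = 0 := by
  -- The pairing is translated in space: the value of `Φ` at `0` is the quantity sought, and each
  -- Fourier coefficient of `Φ` involves only one frequency of `(z, m)`.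
  let Φ : C(Box d, ℝ) := ⟨fun a => (∑ i, ∑ j, pairing (B i j) (shift (entry m i j) a)) +
    ∑ p, pairing (E p) (shift (component z p) a), by fun_prop⟩
  have hΦ : Φ = 0 := by
    refine eq_zero_of_integral_mode Φ fun k c => ?_
    have iB : ∀ i j, Integrable (fun a => pairing (B i j) (shift (entry m i j) a) * mode k c a) :=
      fun i j => integrable_box (by fun_prop)
    have iE : ∀ p, Integrable (fun a => pairing (E p) (shift (component z p) a) * mode k c a) :=
      fun p => integrable_box (by fun_prop)
    have e1 : ∫ a, Φ a * mode k c a =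
        (∑ i, ∑ j, ∫ a, pairing (B i j) (shift (entry m i j) a) * mode k c a) +
        ∑ p, ∫ a, pairing (E p) (shift (component z p) a) * mode k c a := by
      simp only [Φ, ContinuousMap.coe_mk, add_mul, Finset.sum_mul]
      rw [integral_add (integrable_finsetSum _ fun i _ => integrable_finsetSum _ fun j _ => iB i j)
        (integrable_finsetSum _ fun p _ => iE p),
        integral_finsetSum _ fun i _ => integrable_finsetSum _ fun j _ => iB i j,
        integral_finsetSum _ fun p _ => iE p]
      congr 1
      exact Finset.sum_congr rfl fun i _ => integral_finsetSum _ fun j _ => iB i j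
    have swap : ∀ (f : C(Box d, ℝ)) (n : Fin d → Fin d → C(Icc (0 : ℝ) T, ℝ)),
        ∑ i, ∑ j, ∑ p, symb k i j p * pairing (E p) (tensor f (n i j)) =
          ∑ p, pairing (E p) (tensor f (∑ i, ∑ j, symb k i j p • n i j)) := by
      intro f n
      simp only [map_sum, map_smul, smul_eq_mul]
      rw [Finset.sum_congr rfl fun i _ => Finset.sum_comm, Finset.sum_comm]
    rw [e1]
    simp only [integral_shift_mode, pairing_tensor_mode_eq hT hEB, Finset.sum_add_distrib]
    rw [swap, swap]
    -- The frequency relation for `(z, m)` at `w = -i` and `w = 1` turns the `B`-terms into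
    -- `E`-terms opposite to those coming from `z`.
    have c1 : ∀ p, ∑ i, ∑ j, symb k i j p • primitive hT (coef (entry m i j) k 1) =
        coef (component z p) k (-Complex.I) := fun p => by
      rw [coef_eq_of_mem_smoothAnnihilator hT h, mul_neg, Complex.I_mul_I, neg_neg]
    have c2 : ∀ p, ∑ i, ∑ j, symb k i j p • primitive hT (coef (entry m i j) k (-Complex.I)) =
        - coef (component z p) k 1 := fun p => by
      rw [← coef_neg, coef_eq_of_mem_smoothAnnihilator hT h, mul_neg, mul_one]
    simp only [c1, c2, mul_neg, ← mul_assoc, Complex.I_mul_I, neg_mul, one_mul, neg_neg, mode_neg,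
      tensor_neg, map_neg, Finset.sum_neg_distrib]
    ring
  have := DFunLike.congr_fun hΦ 0
  simpa [Φ, shift_zero] using this

end Shift

/-! ### The cone of block matrices and weak duality. -/

section Duality

variable {d : ℕ} {T : ℝ}

variable (T) in
/-- A vector field on `D`, viewed as a time-independent field on `[0,T] × D`. -/
def constInTime (P₀ : C(Box d, Fin d → ℝ)) : C(SpaceTime d T, Fin d → ℝ) :=
  P₀.comp ⟨Prod.snd, continuous_snd⟩

theorem isSubsolution_iff {P₀ : C(Box d, Fin d → ℝ)} {Z : C(SpaceTime d T, Fin d → ℝ)}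
    {M : C(SpaceTime d T, Matrix (Fin d) (Fin d) ℝ)} :
    IsSubsolution T P₀ Z M ↔ (∀ p, (M p - Matrix.vecMulVec (Z p) (Z p)).PosSemidef) ∧
      (Z - constInTime T P₀, M) ∈ smoothAnnihilator d T :=
  ⟨fun h => ⟨h.1, h.2⟩, fun h => ⟨h.1, h.2⟩⟩

theorem integrable_trace (M : C(SpaceTime d T, Matrix (Fin d) (Fin d) ℝ)) :
    Integrable (fun p => (M p).trace) (leb d T) :=
  integrable_leb M.continuous.matrix_trace

variable (d T) in
/-- The energy as a linear functional. -/
def energyₗ : C(SpaceTime d T, Matrix (Fin d) (Fin d) ℝ) →ₗ[ℝ] ℝ where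
  toFun := energy
  map_add' M N := by
    simp only [energy, ContinuousMap.add_apply, Matrix.trace_add]
    rw [integral_add (integrable_trace M) (integrable_trace N)]
    ring
  map_smul' c M := by
    simp only [energy, ContinuousMap.smul_apply, Matrix.trace_smul, smul_eq_mul,
      integral_const_mul, RingHom.id_apply]
    ring

theorem energyₗ_apply (M : C(SpaceTime d T, Matrix (Fin d) (Fin d) ℝ)) :
    energyₗ d T M = energy M := rfl

variable (d T) in
/-- The triples `(r, Z, M)` for which the block matrix with rows `(r, Z)`, `(Z, M)` is symmetric and
positive semidefinite at each point. -/
def blockCone : PointedCone ℝ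
    (ℝ × C(SpaceTime d T, Fin d → ℝ) × C(SpaceTime d T, Matrix (Fin d) (Fin d) ℝ)) where
  carrier := {w | ∀ p, (∀ i j, w.2.2 p i j = w.2.2 p j i) ∧ ∀ (v : Fin d → ℝ) (s : ℝ),
    0 ≤ w.1 * s ^ 2 + 2 * s * (∑ i, w.2.1 p i * v i) + ∑ i, ∑ j, v i * w.2.2 p i j * v j}
  zero_mem' := by intro p; simp
  add_mem' := by
    intro a b ha hb p
    refine ⟨fun i j => ?_, fun v s => ?_⟩
    · simp [(ha p).1 i j, (hb p).1 i j]
    · have := add_nonneg ((ha p).2 v s) ((hb p).2 v s)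
      simp only [Prod.fst_add, Prod.snd_add, ContinuousMap.add_apply, Pi.add_apply,
        Matrix.add_apply, add_mul, mul_add, Finset.sum_add_distrib]
      linarith
  smul_mem' := by
    rintro ⟨c, hc⟩ a ha p
    refine ⟨fun i j => ?_, fun v s => ?_⟩
    · have := (ha p).1 i j
      change c * a.2.2 p i j = c * a.2.2 p j i
      rw [this]
    · have := mul_nonneg hc ((ha p).2 v s)
      change 0 ≤ (c * a.1) * s ^ 2 + 2 * s * (∑ i, (c * a.2.1 p i) * v i) +
        ∑ i, ∑ j, v i * (c * a.2.2 p i j) * v j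
      have e1 : ∑ i, (c * a.2.1 p i) * v i = c * ∑ i, a.2.1 p i * v i := by
        rw [Finset.mul_sum]; exact Finset.sum_congr rfl fun i _ => by ring
      have e2 : ∑ i, ∑ j, v i * (c * a.2.2 p i j) * v j =
          c * ∑ i, ∑ j, v i * a.2.2 p i j * v j := by
        simp only [Finset.mul_sum]
        exact Finset.sum_congr rfl fun i _ => Finset.sum_congr rfl fun j _ => by ring
      rw [e1, e2]
      linarith

theorem mem_blockCone {w : ℝ × C(SpaceTime d T, Fin d → ℝ) ×
    C(SpaceTime d T, Matrix (Fin d) (Fin d) ℝ)} :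
    w ∈ blockCone d T ↔ ∀ p, (∀ i j, w.2.2 p i j = w.2.2 p j i) ∧ ∀ (v : Fin d → ℝ) (s : ℝ),
      0 ≤ w.1 * s ^ 2 + 2 * s * (∑ i, w.2.1 p i * v i) + ∑ i, ∑ j, v i * w.2.2 p i j * v j :=
  Iff.rfl

/-- A Schur complement: with `r = 1` the form in `s` is `(s + Z·v)² + v·(M - Z ⊗ Z)v`, minimal at `s
= -Z·v`. -/
theorem one_mem_blockCone_iff {Z : C(SpaceTime d T, Fin d → ℝ)}
    {M : C(SpaceTime d T, Matrix (Fin d) (Fin d) ℝ)} :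
    (1, Z, M) ∈ blockCone d T ↔ ∀ p, (M p - Matrix.vecMulVec (Z p) (Z p)).PosSemidef := by
  rw [mem_blockCone]
  refine forall_congr' fun p => ?_
  rw [Matrix.posSemidef_iff_dotProduct_mulVec]
  have hq : ∀ v : Fin d → ℝ, star v ⬝ᵥ (M p - Matrix.vecMulVec (Z p) (Z p)).mulVec v =
      (∑ i, ∑ j, v i * M p i j * v j) - (∑ i, Z p i * v i) ^ 2 := by
    intro v
    simp only [dotProduct, Matrix.mulVec, Matrix.sub_apply, Matrix.vecMulVec_apply, star_trivial,
      Finset.mul_sum]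
    rw [sq, Finset.sum_mul_sum, ← Finset.sum_sub_distrib]
    refine Finset.sum_congr rfl fun i _ => ?_
    rw [← Finset.sum_sub_distrib]
    refine Finset.sum_congr rfl fun j _ => ?_
    ring
  have hs : (M p - Matrix.vecMulVec (Z p) (Z p)).IsHermitian ↔ ∀ i j, M p i j = M p j i := by
    rw [Matrix.IsHermitian.ext_iff]
    simp only [Matrix.sub_apply, Matrix.vecMulVec_apply, star_trivial]
    refine forall_congr' fun i => forall_congr' fun j => ?_
    rw [mul_comm (Z p j)]
    constructor <;> intro h <;> linarith
  rw [hs]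
  refine and_congr_right fun _ => forall_congr' fun v => ?_
  rw [hq]
  constructor
  · intro h
    have := h (-(∑ i, Z p i * v i))
    simp only at this
    nlinarith
  · intro h s
    simp only
    nlinarith [sq_nonneg (s + ∑ i, Z p i * v i)]

theorem energy_nonneg_of_mem_blockCone {r : ℝ} {Z : C(SpaceTime d T, Fin d → ℝ)}
    {M : C(SpaceTime d T, Matrix (Fin d) (Fin d) ℝ)} (h : (r, Z, M) ∈ blockCone d T) :
    0 ≤ energy M := by
  refine mul_nonneg (by norm_num) (integral_nonneg fun p => Finset.sum_nonneg fun i _ => ?_)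
  have := (h p).2 (Pi.single i 1) 0
  simpa [Pi.single_apply] using this

/-- Any bound `c` for `|Z|² + ∑ |Mᵢⱼ|` works, by Cauchy–Schwarz; compactness provides one. -/
theorem exists_add_scalar_mem_blockCone (Z : C(SpaceTime d T, Fin d → ℝ))
    (M : C(SpaceTime d T, Matrix (Fin d) (Fin d) ℝ)) (hM : ∀ p i j, M p i j = M p j i) :
    ∃ c : ℝ, (1, Z, ContinuousMap.const _ (c • (1 : Matrix (Fin d) (Fin d) ℝ)) + M) ∈
      blockCone d T := by
  have cz := continuous_component Z
  have cm := continuous_entry M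
  have hc : Continuous fun p => (∑ i, Z p i ^ 2) + ∑ i, ∑ j, |M p i j| :=
    (continuous_finsetSum _ fun i _ => (cz i).pow 2).add
      (continuous_finsetSum _ fun i _ => continuous_finsetSum _ fun j _ => (cm i j).abs)
  obtain ⟨c, hc⟩ := IsCompact.exists_bound_of_continuousOn isCompact_univ hc.continuousOn
  refine ⟨c, fun p => ⟨fun i j => ?_, fun v s => ?_⟩⟩
  · simp [hM p i j, Matrix.one_apply, eq_comm]
  · have hcp := (le_abs_self _).trans (hc p (mem_univ _))
    have e : ∑ i, ∑ j, v i * (c • (1 : Matrix (Fin d) (Fin d) ℝ) + M p) i j * v j = c * (∑ i, v i ^ 2) + ∑ i, ∑ j, v i * M p i j * v j := by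
      simp only [Matrix.add_apply, Matrix.smul_apply, Matrix.one_apply, smul_eq_mul, mul_add, add_mul,
        Finset.sum_add_distrib, Finset.mul_sum]
      congr 1
      refine Finset.sum_congr rfl fun i _ => ?_
      rw [Finset.sum_eq_single i (fun j _ hj => by simp [hj.symm]) (by simp)]
      simp
      ring
    have hm : -((∑ i, ∑ j, |M p i j|) * ∑ i, v i ^ 2) ≤ ∑ i, ∑ j, v i * M p i j * v j := by
      rw [Finset.sum_mul, ← Finset.sum_neg_distrib]
      refine Finset.sum_le_sum fun i _ => ?_
      rw [Finset.sum_mul, ← Finset.sum_neg_distrib]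
      refine Finset.sum_le_sum fun j _ => ?_
      have hi : v i ^ 2 ≤ ∑ i, v i ^ 2 :=
        Finset.single_le_sum (f := fun i => v i ^ 2) (fun _ _ => sq_nonneg _) (Finset.mem_univ i)
      have hj : v j ^ 2 ≤ ∑ i, v i ^ 2 :=
        Finset.single_le_sum (f := fun i => v i ^ 2) (fun _ _ => sq_nonneg _) (Finset.mem_univ j)
      have hij : |v i * v j| ≤ ∑ i, v i ^ 2 := by
        rw [abs_le]
        constructor <;> nlinarith [sq_nonneg (v i + v j), sq_nonneg (v i - v j)]
      have h1 : |M p i j * (v i * v j)| ≤ |M p i j| * ∑ i, v i ^ 2 := by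
        rw [abs_mul]
        exact mul_le_mul_of_nonneg_left hij (abs_nonneg _)
      have := (abs_le.1 h1).1
      linarith
    have hz : (∑ i, Z p i * v i) ^ 2 ≤ (∑ i, Z p i ^ 2) * ∑ i, v i ^ 2 :=
      Finset.sum_mul_sq_le_sq_mul_sq _ _ _
    have hv : 0 ≤ ∑ i, v i ^ 2 := Finset.sum_nonneg fun _ _ => sq_nonneg _
    have hcv := mul_le_mul_of_nonneg_right hcp hv
    change 0 ≤ 1 * s ^ 2 + 2 * s * (∑ i, Z p i * v i) +
      ∑ i, ∑ j, v i * (c • (1 : Matrix (Fin d) (Fin d) ℝ) + M p) i j * v j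
    rw [e]
    nlinarith [sq_nonneg (s + ∑ i, Z p i * v i)]

theorem exists_isSubsolution (hT : 0 < T) (P₀ : C(Box d, Fin d → ℝ)) :
    ∃ Z M, IsSubsolution T P₀ Z M := by
  obtain ⟨c, hc⟩ := exists_add_scalar_mem_blockCone (constInTime T P₀) 0 (by simp)
  rw [add_zero] at hc
  refine ⟨_, _, isSubsolution_iff.2 ⟨one_mem_blockCone_iff.1 hc, ?_⟩⟩
  rw [sub_self]
  exact scalar_mem_smoothAnnihilator hT c

/-- The pairing of a pair of measures `(E, B)` with a pair of continuous functions `(Z, M)`. -/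
def totalPairing (E : Fin d → SignedMeasure (SpaceTime d T))
    (B : Fin d → Fin d → SignedMeasure (SpaceTime d T)) (Z : C(SpaceTime d T, Fin d → ℝ))
    (M : C(SpaceTime d T, Matrix (Fin d) (Fin d) ℝ)) : ℝ :=
  (∑ i, ∑ j, pairing (B i j) (entry M i j)) + ∑ p, pairing (E p) (component Z p)

theorem posSemidef_neg_iff {Z : C(SpaceTime d T, Fin d → ℝ)}
    {M : C(SpaceTime d T, Matrix (Fin d) (Fin d) ℝ)} :
    (∀ p, (M p - Matrix.vecMulVec ((-Z) p) ((-Z) p)).PosSemidef) ↔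
      ∀ p, (M p - Matrix.vecMulVec (Z p) (Z p)).PosSemidef := by
  simp

theorem component_neg (Z : C(SpaceTime d T, Fin d → ℝ)) (i : Fin d) :
    component (-Z) i = - component Z i := rfl

theorem component_sub (Z Z' : C(SpaceTime d T, Fin d → ℝ)) (i : Fin d) :
    component (Z - Z') i = component Z i - component Z' i := rfl

theorem sum_pairing_sub (E : Fin d → SignedMeasure (SpaceTime d T))
    (Z Z' : C(SpaceTime d T, Fin d → ℝ)) :
    ∑ p, pairing (E p) (component (Z - Z') p) =
      ∑ p, pairing (E p) (component Z p) - ∑ p, pairing (E p) (component Z' p) := by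
  simp only [component_sub, map_sub, Finset.sum_sub_distrib]

theorem le_K {E : Fin d → SignedMeasure (SpaceTime d T)}
    {B : Fin d → Fin d → SignedMeasure (SpaceTime d T)} {Z : C(SpaceTime d T, Fin d → ℝ)}
    {M : C(SpaceTime d T, Matrix (Fin d) (Fin d) ℝ)}
    (h : ∀ p, (M p - Matrix.vecMulVec (Z p) (Z p)).PosSemidef) :
    (((∑ p, pairing (E p) (component Z p)) - energy M -
      ∑ i, ∑ j, pairing (B i j) (entry M i j) : ℝ) : EReal) ≤ K E B := by
  refine le_trans (le_of_eq ?_) (le_iSup₂_of_le Z M (le_iSup_of_le h le_rfl))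
  rw [EReal.coe_eq_coe_iff, energy]
  simp only [pairing_apply, component_apply, entry_apply]
  ring

theorem K_le {E : Fin d → SignedMeasure (SpaceTime d T)}
    {B : Fin d → Fin d → SignedMeasure (SpaceTime d T)} {c : ℝ}
    (h : ∀ (Z : C(SpaceTime d T, Fin d → ℝ)) (M : C(SpaceTime d T, Matrix (Fin d) (Fin d) ℝ)),
      (∀ p, (M p - Matrix.vecMulVec (Z p) (Z p)).PosSemidef) →
      (∑ p, pairing (E p) (component Z p)) - energy M -
        ∑ i, ∑ j, pairing (B i j) (entry M i j) ≤ c) : K E B ≤ c := by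
  refine iSup₂_le fun Z M => iSup_le fun hZM => ?_
  rw [EReal.coe_le_coe_iff]
  refine le_trans (le_of_eq ?_) (h Z M hZM)
  rw [energy]
  simp only [pairing_apply, component_apply, entry_apply]
  ring

/-- Weak duality. The pair `(-Z, M)` is admissible in `K`, since `Z ⊗ Z` is even in `Z`;
orthogonality of `(Z - P₀, M)` to `(E, B)` leaves only the energy. -/
theorem relaxedObjective_le_energy (hT : 0 < T) {P₀ : C(Box d, Fin d → ℝ)}
    {Z : C(SpaceTime d T, Fin d → ℝ)} {M : C(SpaceTime d T, Matrix (Fin d) (Fin d) ℝ)}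
    (hZM : IsSubsolution T P₀ Z M) {E : Fin d → SignedMeasure (SpaceTime d T)}
    {B : Fin d → Fin d → SignedMeasure (SpaceTime d T)} (hEB : IsEB T E B) :
    relaxedObjective P₀ E B ≤ (energy M : EReal) := by
  obtain ⟨h1, h2⟩ := isSubsolution_iff.1 hZM
  have h3 := hEB.pairing_eq_zero hT h2
  rw [sum_pairing_sub] at h3
  have h4 := le_K (E := E) (B := B) (posSemidef_neg_iff.2 h1)
  have h5 := EReal.sub_le_sub (EReal.neg_le_neg_iff.2 h4)
    (le_refl ((∑ p, pairing (E p) (component (constInTime T P₀) p) : ℝ) : EReal))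
  refine le_trans h5 ?_
  rw [← EReal.coe_neg, ← EReal.coe_sub, EReal.coe_le_coe_iff]
  simp only [component_neg, map_neg, Finset.sum_neg_distrib]
  linarith

/-- After the change of sign `Z ↦ -Z`, the hypothesis says that every competitor in the supremum `K`
is at most `-J - ∫ P₀ · dE`. -/
theorem le_relaxedObjective {P₀ : C(Box d, Fin d → ℝ)}
    {E : Fin d → SignedMeasure (SpaceTime d T)}
    {B : Fin d → Fin d → SignedMeasure (SpaceTime d T)} {J : ℝ}
    (h : ∀ (Z : C(SpaceTime d T, Fin d → ℝ)) (M : C(SpaceTime d T, Matrix (Fin d) (Fin d) ℝ)),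
      (∀ p, (M p - Matrix.vecMulVec (Z p) (Z p)).PosSemidef) →
      J ≤ energy M + totalPairing E B (Z - constInTime T P₀) M) :
    (J : EReal) ≤ relaxedObjective P₀ E B := by
  set r := ∑ p, pairing (E p) (component (constInTime T P₀) p) with hr
  have hK : K E B ≤ ((-J - r : ℝ) : EReal) := by
    refine K_le fun Z M hZM => ?_
    have := h (-Z) M (posSemidef_neg_iff.2 hZM)
    rw [totalPairing, sum_pairing_sub] at this
    simp only [component_neg, map_neg, Finset.sum_neg_distrib] at this
    linarith
  have h5 := EReal.sub_le_sub (EReal.neg_le_neg_iff.2 hK) (le_refl (r : EReal))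
  refine le_trans (le_of_eq ?_) h5
  rw [← EReal.coe_neg, ← EReal.coe_sub, EReal.coe_eq_coe_iff]
  ring

end Duality

/-! ### M. Riesz extension and representation of the optimal functional by measures. -/

section Attainment

variable {d : ℕ} {T : ℝ}

/-- The field `f(p) • a`, as a linear function of `f`. -/
def smulConst {X V : Type*} [TopologicalSpace X] [AddCommGroup V] [Module ℝ V] [TopologicalSpace V]
    [ContinuousSMul ℝ V] [IsTopologicalAddGroup V] (a : V) : C(X, ℝ) →ₗ[ℝ] C(X, V) where
  toFun f := ⟨fun p => f p • a, by fun_prop⟩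
  map_add' f g := by ext1 p; exact add_smul _ _ _
  map_smul' c f := by ext1 p; exact mul_smul _ _ _

theorem smulConst_apply {X V : Type*} [TopologicalSpace X] [AddCommGroup V] [Module ℝ V]
    [TopologicalSpace V] [ContinuousSMul ℝ V] [IsTopologicalAddGroup V] (a : V) (f : C(X, ℝ))
    (p : X) : smulConst a f p = f p • a := rfl

theorem sum_smulConst_component (Z : C(SpaceTime d T, Fin d → ℝ)) :
    Z = ∑ i, smulConst (Pi.single i (1 : ℝ)) (component Z i) := by
  ext p j
  rw [ContinuousMap.sum_apply, Finset.sum_apply]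
  simp [smulConst_apply, component_apply, Pi.single_apply]

theorem sum_smulConst_entry (M : C(SpaceTime d T, Matrix (Fin d) (Fin d) ℝ)) :
    M = ∑ i, ∑ j, smulConst (Matrix.single i j (1 : ℝ)) (entry M i j) := by
  ext p : 1
  simp only [ContinuousMap.sum_apply, smulConst_apply, entry_apply, Matrix.smul_single, smul_eq_mul,
    mul_one]
  exact Matrix.matrix_eq_sum_single (M p)

/-- Positivity controls a functional only on rank-one matrices `a ⊗ a`; polarization recovers the
symmetrized entries from these. -/
theorem vecMulVec_polarization (i j : Fin d) :
    Matrix.vecMulVec (Pi.single i (1 : ℝ) + Pi.single j 1) (Pi.single i (1 : ℝ) + Pi.single j 1) -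
      Matrix.vecMulVec (Pi.single i (1 : ℝ)) (Pi.single i 1) -
      Matrix.vecMulVec (Pi.single j (1 : ℝ)) (Pi.single j 1) =
      Matrix.single i j 1 + Matrix.single j i 1 := by
  rw [Matrix.single_eq_single_vecMulVec_single, Matrix.single_eq_single_vecMulVec_single]
  simp only [Matrix.vecMulVec_add, Matrix.add_vecMulVec]
  abel

theorem vecMulVec_quadratic (a v : Fin d → ℝ) (c : ℝ) :
    ∑ i, ∑ j, v i * (c • Matrix.vecMulVec a a) i j * v j = c * (∑ i, a i * v i) ^ 2 := by
  rw [sq, Finset.sum_mul_sum, Finset.mul_sum]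
  refine Finset.sum_congr rfl fun i _ => ?_
  rw [Finset.mul_sum]
  refine Finset.sum_congr rfl fun j _ => ?_
  simp only [Matrix.smul_apply, Matrix.vecMulVec_apply, smul_eq_mul]
  ring

theorem smulConst_vecMulVec_mem_blockCone (a : Fin d → ℝ) {f : C(SpaceTime d T, ℝ)}
    (hf : ∀ p, 0 ≤ f p) : (0, 0, smulConst (Matrix.vecMulVec a a) f) ∈ blockCone d T := by
  intro p
  refine ⟨fun i j => ?_, fun v s => ?_⟩
  · simp [smulConst_apply, Matrix.vecMulVec_apply, mul_comm]
  · simp only [smulConst_apply]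
    rw [vecMulVec_quadratic]
    simpa using mul_nonneg (hf p) (sq_nonneg _)

theorem one_smulConst_mem_blockCone (a : Fin d → ℝ) (f : C(SpaceTime d T, ℝ)) :
    (1, smulConst a f, smulConst (Matrix.vecMulVec a a) (f * f)) ∈ blockCone d T := by
  intro p
  refine ⟨fun i j => ?_, fun v s => ?_⟩
  · simp [smulConst_apply, Matrix.vecMulVec_apply, mul_comm]
  · simp only [smulConst_apply]
    rw [vecMulVec_quadratic]
    have e : ∑ i, (f p • a) i * v i = f p * ∑ i, a i * v i := by
      rw [Finset.mul_sum]
      exact Finset.sum_congr rfl fun i _ => by simp [mul_assoc]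
    rw [e, ContinuousMap.mul_apply]
    nlinarith [sq_nonneg (s + f p * ∑ i, a i * v i)]

/-- The linear functional given by the M. Riesz extension theorem. -/
theorem exists_extension (hT : 0 < T) (P₀ : C(Box d, Fin d → ℝ)) {J : ℝ}
    (hJ : ∀ Z M, IsSubsolution T P₀ Z M → J ≤ energy M) :
    ∃ g : (ℝ × C(SpaceTime d T, Fin d → ℝ) × C(SpaceTime d T, Matrix (Fin d) (Fin d) ℝ)) →ₗ[ℝ] ℝ,
      (∀ w ∈ blockCone d T, 0 ≤ g w) ∧ g (1, constInTime T P₀, 0) = -J ∧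
      ∀ z m, (z, m) ∈ smoothAnnihilator d T → g (0, z, m) = energy m := by
  let V := C(SpaceTime d T, Fin d → ℝ)
  let W := C(SpaceTime d T, Matrix (Fin d) (Fin d) ℝ)
  let P : V := constInTime T P₀
  let φ : (ℝ × V × W) →ₗ[ℝ] V × W :=
    LinearMap.prod (LinearMap.fst ℝ V W ∘ₗ LinearMap.snd ℝ ℝ (V × W) -
      (LinearMap.fst ℝ ℝ (V × W)).smulRight P) (LinearMap.snd ℝ V W ∘ₗ LinearMap.snd ℝ ℝ (V × W))
  have hφ : ∀ r z m, φ (r, z, m) = (z - r • P, m) := fun _ _ _ => rfl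
  let l : (ℝ × V × W) →ₗ[ℝ] ℝ := energyₗ d T ∘ₗ LinearMap.snd ℝ V W ∘ₗ LinearMap.snd ℝ ℝ (V × W) -
    J • LinearMap.fst ℝ ℝ (V × W)
  have hl : ∀ r z m, l (r, z, m) = energy m - J * r := fun _ _ _ => rfl
  let D : Submodule ℝ (ℝ × V × W) := (smoothAnnihilator d T).comap φ
  have hD : ∀ r z m, (r, z, m) ∈ D ↔ (z - r • P, m) ∈ smoothAnnihilator d T := fun _ _ _ => Iff.rfl
  obtain ⟨g, hg, hpos⟩ : ∃ g : (ℝ × V × W) →ₗ[ℝ] ℝ, (∀ x : D, g x = l x) ∧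
      ∀ x ∈ blockCone d T, 0 ≤ g x := by
    refine riesz_extension (blockCone d T) ⟨D, l.comp D.subtype⟩ ?_ ?_
    · rintro ⟨⟨r, z, m⟩, hw⟩ hc
      change 0 ≤ l (r, z, m)
      change (r, z, m) ∈ blockCone d T at hc
      rw [hl]
      -- For `r > 0`, dividing by `r` gives a sub-solution, whose energy is at least `J`. For `r =
      -- 0` only nonnegativity of the energy is needed.
      have hr : 0 ≤ r := by
        have := (hc (⟨0, left_mem_Icc.2 hT.le⟩, 0)).2 0 1
        simpa using this
      rcases hr.eq_or_lt with rfl | hr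
      · simpa using energy_nonneg_of_mem_blockCone hc
      · have h1 : (1, r⁻¹ • z, r⁻¹ • m) ∈ blockCone d T := by
          have := (blockCone d T).smul_mem (inv_nonneg.2 hr.le) hc
          convert this using 1
          refine Prod.ext ?_ rfl
          change 1 = r⁻¹ * r
          field_simp
        have h2 : (r⁻¹ • z - P, r⁻¹ • m) ∈ smoothAnnihilator d T := by
          have := (smoothAnnihilator d T).smul_mem r⁻¹ ((hD r z m).1 hw)
          convert this using 1
          refine Prod.ext ?_ rfl
          change r⁻¹ • z - P = r⁻¹ • (z - r • P)
          rw [smul_sub, inv_smul_smul₀ hr.ne']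
        have h3 := hJ _ _ (isSubsolution_iff.2 ⟨one_mem_blockCone_iff.1 h1, h2⟩)
        rw [← energyₗ_apply, map_smul, energyₗ_apply, smul_eq_mul, inv_mul_eq_div, le_div_iff₀ hr] at h3
        linarith
    · rintro ⟨r, z, m⟩
      have cm := continuous_entry m
      let mT : W := ⟨fun p => (m p).transpose, m.continuous.matrix_transpose⟩
      obtain ⟨c, hc⟩ := exists_add_scalar_mem_blockCone (z + (1 - r) • P) ((1 / 2 : ℝ) • (m + mT))
        (fun p i j => by
          change 1 / 2 * (m p i j + m p j i) = 1 / 2 * (m p j i + m p i j)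
          ring)
      have h1 := scalar_mem_smoothAnnihilator (d := d) hT c
      have h2 := antisymm_mem_smoothAnnihilator ((1 / 2 : ℝ) • (mT - m)) (fun p i j => by
          change 1 / 2 * (m p j i - m p i j) = -(1 / 2 * (m p i j - m p j i))
          ring)
      -- Adding this element of `D` makes the first entry `1`, replaces `m` by its symmetric part,
      -- and adds a multiple of the identity large enough to enter the cone.
      refine ⟨⟨(1 - r, (1 - r) • P, ContinuousMap.const _ (c • (1 : Matrix (Fin d) (Fin d) ℝ)) +
        (1 / 2 : ℝ) • (mT - m)), ?_⟩, ?_⟩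
      · change _ ∈ D
        rw [hD, sub_self]
        simpa using! (smoothAnnihilator d T).add_mem h1 h2
      · convert hc using 1
        refine Prod.ext ?_ (Prod.ext ?_ ?_)
        · change 1 - r + r = 1
          ring
        · change (1 - r) • P + z = z + (1 - r) • P
          abel
        · change ContinuousMap.const _ (c • (1 : Matrix (Fin d) (Fin d) ℝ)) +
            (1 / 2 : ℝ) • (mT - m) + m = ContinuousMap.const _ (c • (1 : Matrix (Fin d) (Fin d) ℝ)) +
            (1 / 2 : ℝ) • (m + mT)
          module
  refine ⟨g, hpos, ?_, fun z m h => ?_⟩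
  · have := hg ⟨(1, P, 0), by rw [hD, one_smul, sub_self]; exact Submodule.zero_mem _⟩
    refine this.trans ?_
    change l (1, P, 0) = -J
    rw [hl, ← energyₗ_apply, map_zero]
    ring
  · have := hg ⟨(0, z, m), by rw [hD, zero_smul, sub_zero]; exact h⟩
    refine this.trans ?_
    change l (0, z, m) = energy m
    rw [hl]
    ring

theorem sum_diagonal_integral_eq_energy (M : C(SpaceTime d T, Matrix (Fin d) (Fin d) ℝ)) :
    ∑ i, ∑ j, (if i = j then (1 / 2 : ℝ) else 0) * ∫ p, entry M i j p ∂(leb d T) = energy M := by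
  rw [energy]
  simp only [Matrix.trace, Matrix.diag]
  rw [integral_finsetSum _ fun i _ => integrable_leb (continuous_entry M i i), Finset.mul_sum]
  refine Finset.sum_congr rfl fun i _ => ?_
  rw [Finset.sum_eq_single i (fun j _ hj => by simp [hj.symm]) (by simp), if_pos rfl]
  rfl

/-- A functional which is nonnegative on the cone and equal to the energy on the annihilator is
represented by measures. -/
theorem exists_measures
    (g : (ℝ × C(SpaceTime d T, Fin d → ℝ) × C(SpaceTime d T, Matrix (Fin d) (Fin d) ℝ)) →ₗ[ℝ] ℝ)
    (hpos : ∀ w ∈ blockCone d T, 0 ≤ g w)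
    (hann : ∀ z m, (z, m) ∈ smoothAnnihilator d T → g (0, z, m) = energy m) :
    ∃ (E : Fin d → SignedMeasure (SpaceTime d T))
      (B : Fin d → Fin d → SignedMeasure (SpaceTime d T)), (∀ i j, B i j = B j i) ∧
      ∀ z m, g (0, z, m) = energy m + totalPairing E B z m := by
  let V := C(SpaceTime d T, Fin d → ℝ)
  let W := C(SpaceTime d T, Matrix (Fin d) (Fin d) ℝ)
  let gZ : V →ₗ[ℝ] ℝ := g ∘ₗ LinearMap.inr ℝ ℝ (V × W) ∘ₗ LinearMap.inl ℝ V W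
  let gM : W →ₗ[ℝ] ℝ := g ∘ₗ LinearMap.inr ℝ ℝ (V × W) ∘ₗ LinearMap.inr ℝ V W
  have hgZ : ∀ z, gZ z = g (0, z, 0) := fun _ => rfl
  have hgM : ∀ m, gM m = g (0, 0, m) := fun _ => rfl
  have hsplit : ∀ z m, g (0, z, m) = gM m + gZ z := by
    intro z m
    rw [hgZ, hgM, ← map_add]
    simp
  have hν := fun a : Fin d → ℝ => exists_measure_of_nonneg
    (gM ∘ₗ smulConst (Matrix.vecMulVec a a))
    (fun f hf => hpos _ (smulConst_vecMulVec_mem_blockCone a hf))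
  choose ν hfin hν using hν
  have hE : ∀ i : Fin d, ∃ s : SignedMeasure (SpaceTime d T), ∀ f,
      pairing s f = (gZ ∘ₗ smulConst (Pi.single i (1 : ℝ))) f := by
    intro i
    -- Positivity of `g` at `(1, t f a, t² f² a ⊗ a)` for all real `t` gives a nonnegative quadratic
    -- in `t`. Its discriminant yields the `L²(ν a)` bound, with the constant `4 g(1,0,0)`.
    refine exists_signedMeasure_of_sq_le (ν (Pi.single i 1)) _ (4 * g (1, 0, 0)) fun f => ?_
    set a : Fin d → ℝ := Pi.single i 1
    have hsq : ∫ x, f x ^ 2 ∂(ν a) = gM (smulConst (Matrix.vecMulVec a a) (f * f)) := by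
      rw [← LinearMap.comp_apply, ← hν]
      simp [sq]
    have hq : ∀ t : ℝ, 0 ≤ gM (smulConst (Matrix.vecMulVec a a) (f * f)) * (t * t) +
        gZ (smulConst a f) * t + g (1, 0, 0) := by
      intro t
      have h := hpos _ (one_smulConst_mem_blockCone a (t • f))
      have e : ((1 : ℝ), smulConst a (t • f), smulConst (Matrix.vecMulVec a a) (t • f * t • f)) =
          (1, 0, 0) + (0, smulConst a (t • f), smulConst (Matrix.vecMulVec a a) (t • f * t • f)) := by
        simp
      have e2 : t • f * t • f = (t * t) • (f * f) := by
        ext p; simp; ring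
      rw [e, map_add, hsplit, e2, map_smul, map_smul, map_smul, map_smul] at h
      simp only [smul_eq_mul] at h
      linarith
    have := discrim_le_zero hq
    rw [discrim] at this
    rw [hsq, LinearMap.comp_apply]
    linarith
  choose E hE using hE
  have hsymm : ∀ i j f, gM (smulConst (Matrix.single i j 1) f) =
      gM (smulConst (Matrix.single j i 1) f) := by
    intro i j f
    have h1 : ∀ p a b, (smulConst (Matrix.single i j (1 : ℝ)) f -
        smulConst (Matrix.single j i 1) f : W) p a b =
        -(smulConst (Matrix.single i j (1 : ℝ)) f - smulConst (Matrix.single j i 1) f : W) p b a := by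
      intro p a b
      change f p * Matrix.single i j (1 : ℝ) a b - f p * Matrix.single j i (1 : ℝ) a b =
        -(f p * Matrix.single i j (1 : ℝ) b a - f p * Matrix.single j i (1 : ℝ) b a)
      simp only [Matrix.single_apply, and_comm]
      ring
    -- On antisymmetric fields `g` equals the energy, hence zero, so the `M`-part of `g` depends
    -- only on the symmetric part of `M`.
    have h2 := hann _ _ (antisymm_mem_smoothAnnihilator _ h1)
    have h3 : energy (smulConst (Matrix.single i j (1 : ℝ)) f -
        smulConst (Matrix.single j i 1) f : W) = 0 := by
      have : ∀ p, ((smulConst (Matrix.single i j (1 : ℝ)) f -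
        smulConst (Matrix.single j i 1) f : W) p).trace = 0 := fun p =>
          Finset.sum_eq_zero fun a _ => by
            have := h1 p a a
            rw [Matrix.diag_apply]
            linarith
      simp [energy, this]
    rw [h3, ← hgM, map_sub, sub_eq_zero] at h2
    exact h2
  let e := fun i : Fin d => (Pi.single i 1 : Fin d → ℝ)
  -- Polarization of the positive measures represents the entries of the `M`-part of `g`. The
  -- energy, which is half the Lebesgue measure on the diagonal, is split off.
  let B : Fin d → Fin d → SignedMeasure (SpaceTime d T) := fun i j =>
    (1 / 2 : ℝ) • ((ν (e i + e j)).toSignedMeasure - (ν (e i)).toSignedMeasure -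
      (ν (e j)).toSignedMeasure) - (if i = j then (1 / 2 : ℝ) else 0) • (leb d T).toSignedMeasure
  have hB : ∀ i j f, pairing (B i j) f = gM (smulConst (Matrix.single i j 1) f) -
      (if i = j then (1 / 2 : ℝ) else 0) * ∫ p, f p ∂(leb d T) := by
    intro i j f
    have hpol : (smulConst (Matrix.vecMulVec (e i + e j) (e i + e j)) f -
        smulConst (Matrix.vecMulVec (e i) (e i)) f - smulConst (Matrix.vecMulVec (e j) (e j)) f : W) =
        smulConst (Matrix.single i j 1) f + smulConst (Matrix.single j i 1) f := by
      ext p : 1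
      simp only [ContinuousMap.sub_apply, ContinuousMap.add_apply, smulConst_apply]
      rw [← smul_sub, ← smul_sub, vecMulVec_polarization, smul_add]
    have h := congrArg gM hpol
    rw [map_sub, map_sub, map_add, ← hsymm i j] at h
    simp only [B]
    rw [pairing_sub, pairing_smul, pairing_smul, pairing_sub, pairing_sub, pairing_toSignedMeasure,
      pairing_toSignedMeasure, pairing_toSignedMeasure, pairing_toSignedMeasure, hν, hν, hν]
    simp only [LinearMap.comp_apply]
    linarith
  refine ⟨E, B, fun i j => ?_, fun z m => ?_⟩
  · simp only [B]
    rw [add_comm (e i), sub_right_comm]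
    simp only [eq_comm]
  · have hz : gZ z = ∑ p, pairing (E p) (component z p) := by
      conv_lhs => rw [sum_smulConst_component z]
      rw [map_sum]
      exact Finset.sum_congr rfl fun i _ => (hE i _).symm
    have hm : gM m = energy m + ∑ i, ∑ j, pairing (B i j) (entry m i j) := by
      conv_lhs => rw [sum_smulConst_entry m]
      simp only [map_sum, hB, Finset.sum_sub_distrib]
      rw [sum_diagonal_integral_eq_energy]
      ring
    rw [hsplit, hz, hm, totalPairing]
    ring

/-- The test fields lie in the annihilator, where `g` is the energy, so the measure part of `g`
vanishes on them: this is the constraint of `ℰℬ`. The inequality is nonnegativity of `g` at `(1, Z,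
M)`. -/
theorem exists_isEB (hT : 0 < T) (P₀ : C(Box d, Fin d → ℝ)) {J : ℝ}
    (hJ : ∀ Z M, IsSubsolution T P₀ Z M → J ≤ energy M) :
    ∃ (E : Fin d → SignedMeasure (SpaceTime d T))
      (B : Fin d → Fin d → SignedMeasure (SpaceTime d T)), IsEB T E B ∧
      ∀ (Z : C(SpaceTime d T, Fin d → ℝ)) (M : C(SpaceTime d T, Matrix (Fin d) (Fin d) ℝ)),
      (∀ p, (M p - Matrix.vecMulVec (Z p) (Z p)).PosSemidef) →
      J ≤ energy M + totalPairing E B (Z - constInTime T P₀) M := by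
  obtain ⟨g, hpos, hP, hann⟩ := exists_extension hT P₀ hJ
  obtain ⟨E, B, hsymm, hg⟩ := exists_measures g hpos hann
  refine ⟨E, B, ⟨hsymm, ?_⟩, fun Z M hZM => ?_⟩
  · intro ζ ψ q hζ hζ0 hψ hψs hq
    have hU : UniqueDiffOn ℝ (Icc (0 : ℝ) T) := uniqueDiffOn_Icc hT
    have cζ : Continuous (fun p : SpaceTime d T => ζ p.1) :=
      hζ.continuousOn.comp_continuous (by fun_prop) fun p => p.1.2
    have cζ' : Continuous (fun p : SpaceTime d T => derivWithin ζ (Icc 0 T) p.1) :=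
      (hζ.continuousOn_derivWithin hU (by simp)).comp_continuous (by fun_prop) fun p => p.1.2
    let z : C(SpaceTime d T, Fin d → ℝ) :=
      ⟨fun p k => -(ζ p.1 * ((∑ j, pderiv j (ψ k j) p.2) + pderiv k q p.2)),
        continuous_pi fun k => (cζ.mul ((continuous_finsetSum _ fun j _ =>
          ((hψ k j).pderiv j).continuous.comp continuous_snd).add
            ((hq.1.pderiv k).continuous.comp continuous_snd))).neg⟩
    let m : C(SpaceTime d T, Matrix (Fin d) (Fin d) ℝ) :=
      ⟨fun p => Matrix.of fun i j => derivWithin ζ (Icc 0 T) p.1 * ψ i j p.2,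
        continuous_matrix fun i j => cζ'.mul ((hψ i j).continuous.comp continuous_snd)⟩
    have h := hann _ _ (test_mem_smoothAnnihilator (z := z) (m := m) hT hζ hζ0 hψ hψs hq
      (fun _ _ => rfl) (fun _ _ _ => rfl))
    rw [hg, add_eq_left, totalPairing] at h
    have hz : ∀ k, pairing (E k) (component z k) =
        -∫ᵛ p, ζ (p.1 : ℝ) * ((∑ j, pderiv j (ψ k j) p.2) + pderiv k q p.2) ∂•(E k) := fun k => by
      rw [← VectorMeasure.integral_fun_neg]
      rfl
    simp only [hz, Finset.sum_neg_distrib] at h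
    exact h
  · have h1 := hpos _ (one_mem_blockCone_iff.2 hZM)
    have e : ((1 : ℝ), Z, M) = (1, constInTime T P₀, 0) + (0, Z - constInTime T P₀, M) := by
      simp
    rw [e, map_add, hP, hg] at h1
    linarith

end Attainment
end EulerDuality
end

theorem theorem3 (d : ℕ) (T : ℝ) (hT : 0 < T)
    (P₀ : C(EulerDuality.Box d, Fin d → ℝ)) (hdiv : EulerDuality.IsDivergenceFree P₀)
    (hmean : ∀ i, ∫ x, P₀ x i = 0) :
    ∃ J : ℝ,
      IsGLB {e : ℝ | ∃ Z M, EulerDuality.IsSubsolution T P₀ Z M ∧ e = EulerDuality.energy M} J ∧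
      EulerDuality.relaxedValue T P₀ = (J : EReal) ∧
      ∃ E B, EulerDuality.IsEB T E B ∧ EulerDuality.relaxedObjective P₀ E B = (J : EReal) := by
  obtain ⟨Z₀, M₀, h₀⟩ := EulerDuality.exists_isSubsolution hT P₀
  have hglb := isGLB_csInf
    (s := {e : ℝ | ∃ Z M, EulerDuality.IsSubsolution T P₀ Z M ∧ e = EulerDuality.energy M})
    ⟨_, Z₀, M₀, h₀, rfl⟩ ⟨0, by
      rintro _ ⟨Z, M, h, rfl⟩
      exact EulerDuality.energy_nonneg_of_mem_blockCone
        (EulerDuality.one_mem_blockCone_iff.2 h.ge_tensor)⟩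
  generalize sInf {e : ℝ | ∃ Z M, EulerDuality.IsSubsolution T P₀ Z M ∧
    e = EulerDuality.energy M} = J at hglb
  obtain ⟨E, B, hEB, hJ⟩ := EulerDuality.exists_isEB hT P₀ (J := J)
    fun Z M h => hglb.1 ⟨Z, M, h, rfl⟩
  -- Weak duality against sub-solutions with energy arbitrarily close to the infimum `J`, which need
  -- not be attained.
  have hle : ∀ E B, EulerDuality.IsEB T E B →
      EulerDuality.relaxedObjective P₀ E B ≤ (J : EReal) := by
    intro E B hEB
    refine EReal.le_of_forall_lt_iff_le.1 fun c hc => ?_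
    obtain ⟨_, ⟨Z, M, h, rfl⟩, hlt⟩ := (isGLB_lt_iff hglb).1 (EReal.coe_lt_coe_iff.1 hc)
    exact (EulerDuality.relaxedObjective_le_energy hT h hEB).trans
      (EReal.coe_le_coe_iff.2 hlt.le)
  have hge := EulerDuality.le_relaxedObjective hJ
  exact ⟨J, hglb, le_antisymm (iSup₂_le fun E B => iSup_le fun h => hle E B h)
    (hge.trans (le_iSup₂_of_le E B (le_iSup_of_le hEB le_rfl))), E, B, hEB,
    le_antisymm (hle E B hEB) hge⟩
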